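/- Let $h_1,\dots,h_N$ be bounded self-adjoint operators on a complex Hilbert space $E$, $H=\sum_{j=1}^N h_j$ and $\lambda=\sum_{j=1}^N\|h_j\|$ (operator norm). Let $$U_2(s)=\big(e^{-ih_1s/2}e^{-ih_2s/2}\cdots e^{-ih_Ns/2}\big)\big(e^{-ih_Ns/2}\cdots e^{-ih_2s/2}e^{-ih_1s/2}\big)$$ be the symmetric second-order product formula. A multiproduct formula of order $2m$ is $$U_{\vec k}(s)=\sum_{j=1}^M a_j\,U_2(s/k_j)^{k_j},$$ where $k_1,\dots,k_M$ are distinct positive integers and $a_1,\dots,a_M$ are real numbers with $\sum_j a_j=1$ and $\sum_j a_jk_j^{-2i}=0$ for $1\le i<m$. Circuits act on $E$ together with finitely many ancilla qubits, all initially in $|0\rangle$. They consist of arbitrary one- and two-qubit unitary gates on the ancilla qubits (the additional gates) and of queries to $U_2(s)$, $s\in\mathbb R$, controlled by one ancilla qubit. At the end all ancilla qubits are measured in the computational basis, and the circuit succeeds if all outcomes are $0$. If $A$ denotes the block $(\langle 0|\otimes I)\,V\,(|0\rangle\otimes I)$ of the circuit unitary $V$, then on a unit vector $\psi\in E$ it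 succeeds with probability $\|A\psi\|^2$ and then outputs $A\psi/\|A\psi\|$. Fix $\tau>0$ and $\sigma>1$. There are constants $c,K>0$ depending only on $\tau,\sigma$ such that for all $E$, $N$, $h_1,\dots,h_N$ as above and all real $t$ and $0<\varepsilon\le1$ with $t\lambda\ge\tau$ and $t\lambda/\varepsilon\ge\sigma$ there are an integer $m\ge2$, a multiproduct formula $U_{\vec k}$ of order $2m$ that is well-conditioned, i.e. $\|\vec k\|_1\le K\,m^2\log m$ and $\|\vec a\|_1\le K\log m$, an integer $r\ge1$, and a circuit, such that: 1. $c\,t\lambda\le r\le K\,t\lambda$ and $\|U_{\vec k}(t/r)^r-e^{-itH}\|\le\varepsilon$; 2. the circuit implements $U_{\vec k}(t/r)^r$ to error $\varepsilon$: every query in it is to $U_2(\pm (t/r)/k_j)$ for some $j$, and $\|A-U_{\vec k}(t/r)^r\|\le\varepsilon$, $\|A-e^{-itH}\|\le\varepsilon$; 3. for every unit vector $\psi\in E$ it succeeds with positive probability, which is at least $1-K\varepsilon$, and upon success its output is within norm distance $\varepsilon$ of $e^{-itH}\psi$; 4. it uses at most $K\,t\lambda\log^2(t\lambda/\varepsilon)$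 controlled-$U_2$ queries and at most $K\,t\lambda\log(t\lambda/\varepsilon)$ additional gates. -/

import Mathlib

noncomputable section

namespace MultiproductSim

section Formulas

variable {E : Type*} [NormedAddCommGroup E] [InnerProductSpace ℂ E] [CompleteSpace E]

/-- The time evolution operator `e^{-i s A}` generated by a bounded operator `A`. -/
def evolution (A : E →L[ℂ] E) (s : ℝ) : E →L[ℂ] E :=
  NormedSpace.exp ((-Complex.I * (s : ℂ)) • A)

/-- The Hamiltonian `H = ∑ j, h j`. -/
def hamiltonian {N : ℕ} (h : Fin N → E →L[ℂ] E) : E →L[ℂ] E := ∑ j, h j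

/-- `λ = ∑ j, ‖h j‖`, the norm being the operator norm. -/
def lam {N : ℕ} (h : Fin N → E →L[ℂ] E) : ℝ := ∑ j, ‖h j‖

/-- `e^{-i h₁ s} e^{-i h₂ s} ⋯ e^{-i h_N s}`. -/
def forwardU1 {N : ℕ} (h : Fin N → E →L[ℂ] E) (s : ℝ) : E →L[ℂ] E :=
  (List.ofFn fun j => evolution (h j) s).prod

/-- `e^{-i h_N s} ⋯ e^{-i h₂ s} e^{-i h₁ s}`. -/
def backwardU1 {N : ℕ} (h : Fin N → E →L[ℂ] E) (s : ℝ) : E →L[ℂ] E :=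
  (List.ofFn fun j => evolution (h j) s).reverse.prod

/-- The symmetric second-order product formula. -/
def U2 {N : ℕ} (h : Fin N → E →L[ℂ] E) (s : ℝ) : E →L[ℂ] E :=
  forwardU1 h (s / 2) * backwardU1 h (s / 2)

/-- The multiproduct formula `U_k(s) = ∑ j, a_j U₂(s / k_j) ^ k_j`. -/
def multiproduct {N M : ℕ} (h : Fin N → E →L[ℂ] E) (k : Fin M → ℕ) (a : Fin M → ℝ) (s : ℝ) :
    E →L[ℂ] E :=
  ∑ j, (a j : ℂ) • U2 h (s / (k j : ℝ)) ^ k j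

end Formulas

/-- Exponents `k` and coefficients `a` of a multiproduct formula of order `2 m`: the `k_j` are
distinct positive integers, and `V a = e₁` for the `m × M` Vandermonde matrix `V` with
entries `k_j ^ (-2 i)`, `0 ≤ i < m`. -/
structure IsMultiproduct (m : ℕ) {M : ℕ} (k : Fin M → ℕ) (a : Fin M → ℝ) : Prop where
  pos : ∀ j, 0 < k j
  injective : Function.Injective k
  vandermonde : ∀ i, i < m → ∑ j, (((k j : ℝ) ^ (2 * i))⁻¹) * a j = if i = 0 then 1 else 0

/-- One step of a circuit on `n` ancilla qubits and the simulated system: an arbitrary unitary gate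
on one or on two ancilla qubits, or a query to `U₂(s)`, acting on the system and controlled by the
ancilla qubit `q`. -/
inductive Instr (n : ℕ) where
  | gate1 (q : Fin n) (u : Matrix.unitaryGroup Bool ℂ) : Instr n
  | gate2 (p q : Fin n) (hpq : p ≠ q) (u : Matrix.unitaryGroup (Bool × Bool) ℂ) : Instr n
  | query (q : Fin n) (s : ℝ) : Instr n

/-- A circuit: a list of instructions, the head of the list being executed first. -/
abbrev Circuit (n : ℕ) := List (Instr n)

namespace Circuit

/-- Number of controlled-`U₂` queries. -/
def queryCount {n : ℕ} : Circuit n → ℕ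
  | [] => 0
  | .query _ _ :: C => queryCount C + 1
  | _ :: C => queryCount C

/-- Number of additional (one- and two-qubit) gates. -/
def gateCount {n : ℕ} : Circuit n → ℕ
  | [] => 0
  | .query _ _ :: C => gateCount C
  | _ :: C => gateCount C + 1

end Circuit

/-- The matrix, in the computational basis of `n` qubits, of a one-qubit gate on qubit `q`. -/
def gate1Matrix {n : ℕ} (q : Fin n) (u : Matrix Bool Bool ℂ) :
    Matrix (Fin n → Bool) (Fin n → Bool) ℂ :=
  Matrix.of fun x y => if ∀ i, i ≠ q → x i = y i then u (x q) (y q) else 0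

/-- The matrix, in the computational basis of `n` qubits, of a two-qubit gate on qubits `p, q`. -/
def gate2Matrix {n : ℕ} (p q : Fin n) (u : Matrix (Bool × Bool) (Bool × Bool) ℂ) :
    Matrix (Fin n → Bool) (Fin n → Bool) ℂ :=
  Matrix.of fun x y => if ∀ i, i ≠ p → i ≠ q → x i = y i then u (x p, x q) (y p, y q) else 0

section Semantics

variable {E : Type*} [NormedAddCommGroup E] [InnerProductSpace ℂ E] [CompleteSpace E]

/-- The operator of an instruction on `(ℂ²)^{⊗ n} ⊗ E`, written as a block matrix: its `(x, y)`
block is the operator `⟨x| · |y⟩` on the system space `E`. -/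
def Instr.eval {n N : ℕ} (h : Fin N → E →L[ℂ] E) :
    Instr n → Matrix (Fin n → Bool) (Fin n → Bool) (E →L[ℂ] E)
  | .gate1 q u => (gate1Matrix q u.1).map fun z => z • (1 : E →L[ℂ] E)
  | .gate2 p q _ u => (gate2Matrix p q u.1).map fun z => z • (1 : E →L[ℂ] E)
  | .query q s => Matrix.diagonal fun x => if x q = true then U2 h s else 1

/-- The operator of a circuit, as a block matrix. -/
def Circuit.eval {n N : ℕ} (h : Fin N → E →L[ℂ] E) :
    Circuit n → Matrix (Fin n → Bool) (Fin n → Bool) (E →L[ℂ] E)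
  | [] => 1
  | g :: C => Circuit.eval h C * g.eval h

/-- The operator applied to the system when all ancilla qubits start in `|0⟩`, are measured in the
computational basis at the end, and are all found in `|0⟩`; this outcome is called success. -/
def Circuit.successOp {n N : ℕ} (h : Fin N → E →L[ℂ] E) (C : Circuit n) : E →L[ℂ] E :=
  C.eval h (fun _ => false) (fun _ => false)

/-- The probability of success on the system input state `ψ` (a unit vector). -/
def Circuit.successProb {n N : ℕ} (h : Fin N → E →L[ℂ] E) (C : Circuit n) (ψ : E) : ℝ :=
  ‖C.successOp h ψ‖ ^ 2

/-- The state of the system after success, on the input state `ψ`. -/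
def Circuit.output {n N : ℕ} (h : Fin N → E →L[ℂ] E) (C : Circuit n) (ψ : E) : E :=
  ((‖C.successOp h ψ‖⁻¹ : ℝ) : ℂ) • C.successOp h ψ

end Semantics

end MultiproductSim

end

/-!
Why the theorem holds.

*Coefficients.* The conditions on `k` and `a` say that `∑ j, a j * p (1 / k j ^ 2) = p 0` for all
polynomials `p` of degree `< m`. By Hahn–Banach (`exists_extrapolation`) such `a` with
`∑ j, |a j| ≤ 2` exist as soon as `|p 0| ≤ 2 * max_j |p (1 / k j ^ 2)|`. Seen on the unit circle,
`p` becomes a trigonometric polynomial, and Bernstein's inequality gives this bound if the nodes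
are dense at scale `1 / m` (`abs_eval_zero_le_of_net`). Integers `k j`, distributed like `m ^ 2 / l`,
are that dense except on a short arc at the largest values of `1 / k ^ 2`; nodes on this arc may be
fictitious, since `p` can be multiplied by a polynomial that vanishes there
(`abs_eval_zero_le_of_nodes`). The result, `exists_wellConditioned`, even has `∑ j, |a j|` bounded.

*Approximation.* Let `Z` be the power series of `U₂`. As `Z` has constant term `1`, the `n`-th
coefficient of `Z ^ k` is a polynomial in `k` of degree at most `n`, and `Z(-s) Z(s) = 1` makes it
even or odd (`eval_neg_powPoly`). So the `n`-th coefficient of `Z(s / k) ^ k` is a polynomial in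
`1 / k ^ 2` of degree less than `n / 2`, whose constant term is that of `exp (-i s H)`, and a
multiproduct formula reproduces it for `n ≤ 2 m` (`sum_coeff_pow_eq`). All coefficients are
majorized by those of `exp (λ s)`, so for `|s| λ ≤ 1` the error is `O(1 / (2 m + 1)!)`
(`norm_multiproduct_sub_evolution_le`).

*Circuit.* Each of the `r` steps has its own register, with one qubit for every term of the
formula and two idle ones, in the span of the states with a single qubit in `|1⟩`. There the
preparation of a superposition needs one two-qubit gate for every term, the selection of a
term is a query controlled by its qubit, and the reflection in the initial state is a Pauli `Z`.
Since `∑ j, |a j| ≤ 2`, the formula `X` can be prepared with amplitude exactly `1 / 2`, and one round of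
amplitude amplification yields `(3 X - X X' X) / 2` with `X'` the formula at negative time
(`exists_step_circuit`); for `X` near a unitary with inverse near `X'`, this is near `X`. As
the registers are disjoint, the success operator of the whole circuit is the `r`-th power of that of
a step (`exists_circuit_pow`).

*Parameters.* With `r = ⌈t λ⌉` and the least `m` with `m log m ≥ log (t λ / ε) + O(1)`, the total
error `O(r / (2 m + 1)!)` is below `ε`. A step costs `O(m ^ 2 log m)` queries and `O(m)` gates, and
`m log m = O(log (t λ / ε))`.
-/

noncomputable section

namespace MultiproductSim

/-! ### Extrapolation of polynomials from a net on the circle -/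

open Polynomial in
/-- The growth of a polynomial outside the unit disc. For `1 < ‖z‖` the maximum modulus principle
is applied to the reflected polynomial at `z⁻¹`. -/
lemma norm_eval_le_of_norm_le {Q : ℂ[X]} {n : ℕ} {C : ℝ} (hQ : Q.natDegree ≤ n)
    (hC : ∀ w : ℂ, ‖w‖ = 1 → ‖Q.eval w‖ ≤ C) {R : ℝ} (hR : 1 ≤ R) {z : ℂ} (hz : ‖z‖ ≤ R) :
    ‖Q.eval z‖ ≤ R ^ n * C := by
  -- the maximum modulus principle on the closed unit disc
  have disc : ∀ P : ℂ[X], (∀ w : ℂ, ‖w‖ = 1 → ‖P.eval w‖ ≤ C) →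
      ∀ x : ℂ, ‖x‖ ≤ 1 → ‖P.eval x‖ ≤ C := by
    intro P hP x hx
    refine Complex.norm_le_of_forall_mem_frontier_norm_le (f := fun w => P.eval w)
      (U := Metric.ball (0 : ℂ) 1) Metric.isBounded_ball P.differentiable.diffContOnCl ?_ ?_
    · intro w hw
      rw [frontier_ball (0 : ℂ) one_ne_zero] at hw
      exact hP w (by simpa using hw)
    · rw [closure_ball (0 : ℂ) one_ne_zero]
      simpa using hx
  have hC0 : 0 ≤ C := (norm_nonneg _).trans (hC 1 (by simp))
  have hRn : 1 ≤ R ^ n := one_le_pow₀ hR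
  rcases le_or_gt ‖z‖ 1 with h1 | h1
  · exact (disc Q hC z h1).trans (by nlinarith)
  · have hz0 : z ≠ 0 := by
      rintro rfl
      simp at h1
      linarith
    let _ : Invertible z := invertibleOfNonzero hz0
    have key : ∀ x : ℂ, x ≠ 0 → eval x⁻¹ (reflect n Q) * x ^ n = eval x Q := by
      intro x hx
      let _ : Invertible x := invertibleOfNonzero hx
      have := eval₂_reflect_mul_pow (RingHom.id ℂ) x n Q hQ
      simpa [eval₂_eq_eval_map] using this
    have hrefl : ∀ w : ℂ, ‖w‖ = 1 → ‖(reflect n Q).eval w‖ ≤ C := by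
      intro w hw
      have hw0 : w ≠ 0 := by
        rintro rfl
        simp at hw
      have := key w⁻¹ (inv_ne_zero hw0)
      rw [inv_inv] at this
      have h2 := hC w⁻¹ (by simp [hw])
      rw [← this, norm_mul, norm_pow, norm_inv, hw] at h2
      simpa using h2
    rw [← key z hz0, norm_mul, norm_pow, mul_comm]
    have h3 := disc _ hrefl z⁻¹ (by rw [norm_inv]; exact inv_le_one_of_one_le₀ h1.le)
    gcongr

open Polynomial in
/-- A weak form of Bernstein's inequality. Cauchy's estimate on discs of radius `1 / n` loses a
constant factor against the optimal bound `n * C`. -/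
lemma norm_eval_sub_eval_le {Q : ℂ[X]} {n : ℕ} {C : ℝ} (hn : 0 < n) (hQ : Q.natDegree ≤ n)
    (hC : ∀ w : ℂ, ‖w‖ = 1 → ‖Q.eval w‖ ≤ C) {w w' : ℂ} (hw : ‖w‖ = 1) (hw' : ‖w'‖ = 1) :
    ‖Q.eval w' - Q.eval w‖ ≤ 3 * n * C * ‖w' - w‖ := by
  have hC0 : 0 ≤ C := (norm_nonneg _).trans (hC 1 (by simp))
  have hn' : (0 : ℝ) < n := by exact_mod_cast hn
  have hpow : (1 + 1 / (n : ℝ)) ^ n ≤ 3 := by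
    have h1 : (1 + 1 / (n : ℝ)) ≤ Real.exp (1 / n) := by
      linarith [Real.add_one_le_exp (1 / (n : ℝ))]
    calc (1 + 1 / (n : ℝ)) ^ n ≤ Real.exp (1 / n) ^ n := by gcongr
      _ = Real.exp 1 := by
        rw [← Real.exp_nat_mul]
        congr 1
        field_simp
      _ ≤ 3 := Real.exp_one_lt_three.le
  have hder : ∀ z ∈ Metric.closedBall (0 : ℂ) 1, ‖deriv (fun x => Q.eval x) z‖ ≤ 3 * n * C := by
    intro z hz
    have hz1 : ‖z‖ ≤ 1 := by simpa using hz
    have := Complex.norm_deriv_le_of_forall_mem_sphere_norm_le (c := z) (R := 1 / n)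
      (C := 3 * C) (f := fun x => Q.eval x) (by positivity)
      Q.differentiable.diffContOnCl (by
        intro x hx
        have hx' : ‖x - z‖ = 1 / n := by simpa [dist_eq_norm] using hx
        have hx1 : ‖x‖ ≤ 1 + 1 / n := by
          calc ‖x‖ = ‖z + (x - z)‖ := by ring_nf
            _ ≤ ‖z‖ + ‖x - z‖ := norm_add_le _ _
            _ ≤ 1 + 1 / n := by linarith
        refine (norm_eval_le_of_norm_le hQ hC (by linarith [show 0 < 1 / (n : ℝ) by positivity])
          hx1).trans ?_
        gcongr)
    refine this.trans (le_of_eq ?_)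
    field_simp
  exact (convex_closedBall (0 : ℂ) 1).norm_image_sub_le_of_norm_deriv_le
    (fun x _ => Q.differentiable.differentiableAt) hder (by simp [hw]) (by simp [hw'])

open Polynomial in
/-- Extrapolation to `0` from a net: a real polynomial `P` of degree at most `D` is seen on the
unit circle through `w = z ^ 2`, `z = κ + i s`, as `w ^ D * P (s ^ 2)`, a polynomial of degree
`2 D` in `w`. If near every point of the circle there is one where `P (s' ^ 2)` is at most `B` in
absolute value, then `P 0`, the value at `w = 1`, is at most `2 B`. By symmetry it suffices to consider
the first quadrant. -/
lemma abs_eval_zero_le_of_net {P : ℝ[X]} {D : ℕ} {B : ℝ} (hD : 0 < D) (hP : P.natDegree ≤ D)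
    (net : ∀ κ s : ℝ, 0 ≤ κ → 0 ≤ s → κ ^ 2 + s ^ 2 = 1 → ∃ κ' s' : ℝ, κ' ^ 2 + s' ^ 2 = 1 ∧
      |κ - κ'| + |s - s'| ≤ 1 / (24 * D) ∧ |P.eval (s' ^ 2)| ≤ B) :
    |P.eval 0| ≤ 2 * B := by
  have hD' : (0 : ℝ) < D := by exact_mod_cast hD
  set V : ℂ[X] := C (-1 / 4) * (X - 1) ^ 2 with hV
  set Q : ℂ[X] := ∑ i ∈ Finset.range (D + 1), C (P.coeff i : ℂ) * (X ^ (D - i) * V ^ i) with hQ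
  have hVdeg : V.natDegree ≤ 2 := by
    rw [hV]
    refine (natDegree_C_mul_le _ _).trans ?_
    refine (natDegree_pow_le).trans ?_
    have : (X - 1 : ℂ[X]).natDegree ≤ 1 := by
      rw [← C_1, natDegree_X_sub_C]
    omega
  have hQdeg : Q.natDegree ≤ 2 * D := by
    rw [hQ]
    refine natDegree_sum_le_of_forall_le _ _ fun i hi => ?_
    have hi' : i ≤ D := by simpa [Nat.lt_succ_iff] using hi
    refine (natDegree_C_mul_le _ _).trans ?_
    refine natDegree_mul_le.trans ?_
    have h1 : (X ^ (D - i) : ℂ[X]).natDegree ≤ D - i := natDegree_X_pow_le _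
    have h2 : (V ^ i).natDegree ≤ i * 2 := natDegree_pow_le_of_le i hVdeg
    omega
  have heval : ∀ κ s : ℝ, κ ^ 2 + s ^ 2 = 1 →
      Q.eval (((κ : ℂ) + s * Complex.I) ^ 2) =
        (((κ : ℂ) + s * Complex.I) ^ 2) ^ D * (P.eval (s ^ 2) : ℝ) := by
    intro κ s hks
    set w : ℂ := ((κ : ℂ) + s * Complex.I) ^ 2 with hw
    have hks' : (κ : ℂ) ^ 2 + (s : ℂ) ^ 2 = 1 := by exact_mod_cast hks
    have hVw : V.eval w = w * (s : ℂ) ^ 2 := by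
      simp only [hV, eval_mul, eval_C, eval_pow, eval_sub, eval_X, eval_one, hw]
      have : ((κ : ℂ) + s * Complex.I) ^ 2 - 1 = 2 * Complex.I * s * (κ + s * Complex.I) := by
        linear_combination hks' - (s : ℂ) ^ 2 * Complex.I_sq
      rw [this]
      linear_combination (-(s : ℂ) ^ 2 * (κ + s * Complex.I) ^ 2) * Complex.I_sq
    rw [hQ, eval_finsetSum, eval_eq_sum_range' (Nat.lt_succ_of_le hP)]
    push_cast
    rw [Finset.mul_sum]
    refine Finset.sum_congr rfl fun i hi => ?_
    have hi' : i ≤ D := by simpa [Nat.lt_succ_iff] using hi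
    rw [eval_mul, eval_C, eval_mul, eval_pow, eval_X, eval_pow, hVw, mul_pow]
    have : w ^ D = w ^ (D - i) * w ^ i := by rw [← pow_add, Nat.sub_add_cancel hi']
    rw [this]
    ring
  have hnorm : ∀ κ s : ℝ, κ ^ 2 + s ^ 2 = 1 → ‖(κ : ℂ) + s * Complex.I‖ = 1 := by
    intro κ s hks
    rw [Complex.norm_add_mul_I, hks, Real.sqrt_one]
  have hnormQ : ∀ κ s : ℝ, κ ^ 2 + s ^ 2 = 1 →
      ‖Q.eval (((κ : ℂ) + s * Complex.I) ^ 2)‖ = |P.eval (s ^ 2)| := by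
    intro κ s hks
    rw [heval κ s hks, norm_mul, norm_pow, norm_pow, hnorm κ s hks]
    simp
  have hroot : ∀ w : ℂ, ‖w‖ = 1 → ∃ κ s : ℝ, κ ^ 2 + s ^ 2 = 1 ∧
      w = ((κ : ℂ) + s * Complex.I) ^ 2 := by
    intro w hw
    obtain ⟨z, hz⟩ := IsAlgClosed.exists_pow_nat_eq w (n := 2) (by norm_num)
    have hz1 : ‖z‖ = 1 := by
      have : ‖z‖ ^ 2 = 1 := by rw [← norm_pow, hz, hw]
      nlinarith [norm_nonneg z]
    refine ⟨z.re, z.im, ?_, by rw [Complex.re_add_im, hz]⟩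
    have := Complex.sq_norm z
    rw [hz1, Complex.normSq_apply] at this
    nlinarith
  -- the maximum of `|P (s ^ 2)|` over the circle
  obtain ⟨w₀, hw₀, hmax⟩ := (isCompact_sphere (0 : ℂ) 1).exists_isMaxOn
    ⟨1, by simp⟩ (f := fun w => ‖Q.eval w‖) (Q.continuous.norm.continuousOn)
  have hw₀' : ‖w₀‖ = 1 := by simpa using hw₀
  set C₀ := ‖Q.eval w₀‖ with hC₀
  have hC : ∀ w : ℂ, ‖w‖ = 1 → ‖Q.eval w‖ ≤ C₀ := fun w hw => hmax (by simpa using hw)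
  obtain ⟨κ, s, hks, hw₀e⟩ := hroot w₀ hw₀'
  have hC₀P : C₀ = |P.eval (s ^ 2)| := by rw [hC₀, hw₀e, hnormQ κ s hks]
  have habs : |κ| ^ 2 + |s| ^ 2 = 1 := by rw [sq_abs, sq_abs, hks]
  obtain ⟨κ', s', hks', hdist, hB⟩ := net |κ| |s| (abs_nonneg _) (abs_nonneg _) habs
  set z : ℂ := (|κ| : ℝ) + (|s| : ℝ) * Complex.I with hz
  set z' : ℂ := κ' + s' * Complex.I with hz'
  have hz1 : ‖z‖ = 1 := hnorm _ _ habs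
  have hz1' : ‖z'‖ = 1 := hnorm _ _ hks'
  have hzz : ‖z - z'‖ ≤ 1 / (24 * D) := by
    refine le_trans ?_ hdist
    have : z - z' = ((|κ| - κ' : ℝ) : ℂ) + ((|s| - s' : ℝ) : ℂ) * Complex.I := by
      rw [hz, hz']; push_cast; ring
    rw [this]
    refine (norm_add_le _ _).trans (le_of_eq ?_)
    rw [norm_mul, Complex.norm_I, mul_one, Complex.norm_real, Complex.norm_real]
    rfl
  have hzz2 : ‖z ^ 2 - z' ^ 2‖ ≤ 1 / (12 * D) := by
    have : z ^ 2 - z' ^ 2 = (z + z') * (z - z') := by ring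
    rw [this, norm_mul]
    have h2 : ‖z + z'‖ ≤ 2 := (norm_add_le _ _).trans (by rw [hz1, hz1']; norm_num)
    calc ‖z + z'‖ * ‖z - z'‖ ≤ 2 * (1 / (24 * D)) := by gcongr
      _ = 1 / (12 * D) := by field_simp; norm_num
  have hB1 := norm_eval_sub_eval_le (n := 2 * D) (by omega) hQdeg hC
    (w := z' ^ 2) (w' := z ^ 2) (by rw [norm_pow, hz1', one_pow]) (by rw [norm_pow, hz1, one_pow])
  have hC₀0 : 0 ≤ C₀ := norm_nonneg _
  have h5 : 3 * ((2 * D : ℕ) : ℝ) * C₀ * ‖z ^ 2 - z' ^ 2‖ ≤ C₀ / 2 := by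
    calc 3 * ((2 * D : ℕ) : ℝ) * C₀ * ‖z ^ 2 - z' ^ 2‖
        ≤ 3 * ((2 * D : ℕ) : ℝ) * C₀ * (1 / (12 * D)) := by gcongr
      _ = C₀ / 2 := by push_cast; field_simp; ring
  have h6 : ‖Q.eval (z ^ 2)‖ = C₀ := by rw [hnormQ _ _ habs, hC₀P, sq_abs]
  have h7 : ‖Q.eval (z' ^ 2)‖ ≤ B := by rw [hnormQ _ _ hks']; exact hB
  have h8 := norm_sub_norm_le (Q.eval (z ^ 2)) (Q.eval (z' ^ 2))
  have h9 : |P.eval 0| ≤ C₀ := by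
    have := hnormQ 1 0 (by norm_num)
    simp only [ne_eq, OfNat.ofNat_ne_zero, not_false_eq_true, zero_pow] at this
    rw [← this]
    exact hC _ (by simp)
  linarith

/-! ### The nodes of the multiproduct formula -/

/-- On the first quadrant of the unit circle, one coordinate controls the other. -/
lemma abs_sub_le_of_circle {κ s κ' s' c : ℝ} (h : κ ^ 2 + s ^ 2 = 1) (h' : κ' ^ 2 + s' ^ 2 = 1)
    (hκ : 0 ≤ κ) (hκ' : 0 ≤ κ') (hs : 0 < s + s') (hc : κ + κ' ≤ c * (s + s')) :
    |s - s'| ≤ c * |κ - κ'| := by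
  have h1 : |s - s'| * (s + s') = |κ - κ'| * (κ + κ') := by
    have e : (s - s') * (s + s') = -((κ - κ') * (κ + κ')) := by linarith
    have := congrArg abs e
    rwa [abs_neg, abs_mul, abs_mul, abs_of_pos hs, abs_of_nonneg (add_nonneg hκ hκ')] at this
  refine le_of_mul_le_mul_right ?_ hs
  rw [h1]
  calc |κ - κ'| * (κ + κ') ≤ |κ - κ'| * (c * (s + s')) := by gcongr
    _ = c * |κ - κ'| * (s + s') := by ring

/-- The exponents of the multiproduct formula. With `A = 20000 m`, the numbers `A / k` are close to
the equidistant points `l / A`. Points too close to `1`, where the preimage on the circle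
would need a finer net than integers provide, are left out: they are those with
`κ = √(1 - (A / k) ^ 2) < 1 / 96`, an arc that `m` points `κ = q / (96 m)` cover with the precision
required for degree `2 m`. On the rest of the circle the spacing `1 / A` of the points and their
rounding error, amplified by `1 / κ`, stay below that precision. -/
def nodes (m : ℕ) : Finset ℕ :=
  ((Finset.Icc 1 (20000 * m)).image fun l : ℕ => ⌈((20000 * m : ℕ) : ℝ) ^ 2 / l⌉₊).filter
    fun k => (((20000 * m : ℕ) : ℝ) / k) ^ 2 ≤ 1 - (1 / 96) ^ 2

lemma ceil_node_bounds {A l : ℕ} (hl : 1 ≤ l) (hlA : l ≤ A) :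
    (A : ℝ) / ⌈(A : ℝ) ^ 2 / l⌉₊ ≤ l / A ∧ (l : ℝ) / A - 1 / A ≤ A / ⌈(A : ℝ) ^ 2 / l⌉₊ := by
  have hl' : (0 : ℝ) < l := by exact_mod_cast hl
  have hA : (0 : ℝ) < A := by exact_mod_cast hl.trans hlA
  have hlA' : (l : ℝ) ≤ A := by exact_mod_cast hlA
  set k := ⌈(A : ℝ) ^ 2 / l⌉₊
  have h1 : (A : ℝ) ^ 2 / l ≤ k := Nat.le_ceil _
  have h2 : (k : ℝ) < (A : ℝ) ^ 2 / l + 1 := Nat.ceil_lt_add_one (by positivity)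
  have h3 : (A : ℝ) ^ 2 ≤ k * l := by rwa [div_le_iff₀ hl'] at h1
  have h4 : (k : ℝ) * l < A ^ 2 + l := by
    have := mul_lt_mul_of_pos_right h2 hl'
    rwa [add_mul, div_mul_cancel₀ _ hl'.ne', one_mul] at this
  have hk : (A : ℝ) ≤ k := by nlinarith
  have hk0 : (0 : ℝ) < k := hA.trans_le hk
  constructor
  · rw [div_le_div_iff₀ hk0 hA]
    nlinarith
  · rw [← sub_div, div_le_div_iff₀ hA hk0]
    nlinarith

lemma pos_of_mem_nodes {m k : ℕ} (hk : k ∈ nodes m) : 0 < k := by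
  obtain ⟨⟨l, ⟨hl, hlA⟩, rfl⟩, -⟩ := by
    simpa only [nodes, Finset.mem_filter, Finset.mem_image, Finset.mem_Icc] using hk
  have hl' : (0 : ℝ) < l := by exact_mod_cast hl
  have hA : (0 : ℝ) < (20000 * m : ℕ) := by exact_mod_cast (show 0 < 20000 * m by omega)
  exact Nat.ceil_pos.2 (by positivity)

open Polynomial in
/-- The nodes `1 / k ^ 2` determine the value at `0` of a polynomial of degree `< m` up to a
factor `2`. The part of the net on the circle that contains no nodes is made harmless by
multiplying with a polynomial that vanishes there and takes values in `[0, 1]` on the nodes;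
that part is short enough for the degree to grow by `m` only. -/
lemma abs_eval_zero_le_of_nodes {m : ℕ} {p : ℝ[X]} {B : ℝ} (hp : p.natDegree < m)
    (hB : ∀ k ∈ nodes m, |p.eval (((k : ℝ) ^ 2)⁻¹)| ≤ B) : |p.eval 0| ≤ 2 * B := by
  have hm : 0 < m := by omega
  have hm' : (0 : ℝ) < m := by exact_mod_cast hm
  have hm1 : (1 : ℝ) ≤ m := by exact_mod_cast hm
  obtain ⟨A, hA⟩ : ∃ A : ℕ, A = 20000 * m := ⟨_, rfl⟩
  have hAm : (A : ℝ) = 20000 * m := by rw [hA]; push_cast; ring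
  have hA0 : (0 : ℝ) < A := by rw [hAm]; positivity
  -- the value at the node coming from `l`
  have hnode : ∀ l : ℕ, 1 ≤ l → l ≤ A → ((A : ℝ) / ⌈(A : ℝ) ^ 2 / l⌉₊) ^ 2 ≤ 1 - (1 / 96) ^ 2 →
      |p.eval (((A : ℝ) / ⌈(A : ℝ) ^ 2 / l⌉₊) ^ 2 * ((A : ℝ) ^ 2)⁻¹)| ≤ B := by
    intro l hl hlA hk
    have := hB ⌈(A : ℝ) ^ 2 / l⌉₊ (by
      simp only [nodes, ← hA, Finset.mem_filter, Finset.mem_image, Finset.mem_Icc]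
      exact ⟨⟨l, ⟨hl, hlA⟩, rfl⟩, hk⟩)
    convert this using 3
    field_simp
  have hB0 : 0 ≤ B := by
    have h1 := ceil_node_bounds (A := A) (l := 1) le_rfl (by omega)
    refine (abs_nonneg _).trans (hnode 1 le_rfl (by omega) ?_)
    have h2 : (A : ℝ) / ⌈(A : ℝ) ^ 2 / (1 : ℕ)⌉₊ ≤ 1 / 2 := by
      refine h1.1.trans ?_
      rw [div_le_div_iff₀ hA0 (by norm_num), hAm]
      push_cast
      linarith
    have h3 : 0 ≤ (A : ℝ) / ⌈(A : ℝ) ^ 2 / (1 : ℕ)⌉₊ := by positivity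
    nlinarith
  set y : ℕ → ℝ := fun q => 1 - ((q : ℝ) / (96 * m)) ^ 2 with hy
  have hybd : ∀ q ∈ Finset.range m, 1 - (1 / 96) ^ 2 ≤ y q := by
    intro q hq
    have hq' : (q : ℝ) ≤ m := by exact_mod_cast (Finset.mem_range.1 hq).le
    have h1 : (q : ℝ) / (96 * m) ≤ 1 / 96 := by
      rw [div_le_div_iff₀ (by positivity) (by norm_num)]
      linarith
    have h2 : 0 ≤ (q : ℝ) / (96 * m) := by positivity
    simp only [hy]
    gcongr
  set W : ℝ[X] := ∏ q ∈ Finset.range m, (1 - C (y q)⁻¹ * X) with hW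
  set P : ℝ[X] := p.comp (C ((A : ℝ) ^ 2)⁻¹ * X) * W with hP
  have hWe : ∀ x, W.eval x = ∏ q ∈ Finset.range m, (1 - (y q)⁻¹ * x) := by
    intro x
    simp [hW, eval_prod]
  have hPe : ∀ x, P.eval x = p.eval (x * ((A : ℝ) ^ 2)⁻¹) * W.eval x := by
    intro x
    rw [hP, eval_mul, eval_comp, eval_mul, eval_C, eval_X, mul_comm x]
  have hdeg : P.natDegree ≤ 2 * m := by
    have h1 : W.natDegree ≤ m := by
      refine (natDegree_prod_le _ _).trans ?_
      refine (Finset.sum_le_card_nsmul _ _ 1 fun q _ => ?_).trans (by simp)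
      refine (natDegree_sub_le _ _).trans ?_
      simp only [natDegree_one, max_le_iff, zero_le, true_and]
      exact (natDegree_C_mul_le _ _).trans natDegree_X_le
    have h2 : (p.comp (C ((A : ℝ) ^ 2)⁻¹ * X)).natDegree ≤ p.natDegree := by
      refine natDegree_comp_le.trans ?_
      have : (C ((A : ℝ) ^ 2)⁻¹ * X).natDegree ≤ 1 :=
        (natDegree_C_mul_le _ _).trans natDegree_X_le
      calc _ ≤ p.natDegree * 1 := Nat.mul_le_mul_left _ this
        _ = _ := mul_one _
    exact natDegree_mul_le.trans (by omega)
  have hP0 : P.eval 0 = p.eval 0 := by simp [hPe, hWe]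
  rw [← hP0]
  refine abs_eval_zero_le_of_net (D := 2 * m) (by omega) hdeg fun κ s hκ hs hks => ?_
  have hs1 : s ≤ 1 := by nlinarith
  have hκ1 : κ ≤ 1 := by nlinarith
  rcases lt_or_ge κ (1 / 96) with hbad | hgood
  · -- on this arc the factor of `W` at `y q` makes `P` vanish at a nearby point
    set q := ⌊κ * (96 * m)⌋₊ with hq
    have hq1 : (q : ℝ) ≤ κ * (96 * m) := Nat.floor_le (by positivity)
    have hq2 : κ * (96 * m) < q + 1 := Nat.lt_floor_add_one _
    have hqm : q < m := by
      have : (q : ℝ) < m := by nlinarith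
      exact_mod_cast this
    set κ' : ℝ := q / (96 * m) with hκ'
    have hκ'0 : 0 ≤ κ' := by positivity
    have hκ'1 : κ' ≤ κ := by rwa [hκ', div_le_iff₀ (by positivity)]
    have hκ'2 : κ - κ' ≤ 1 / (96 * m) := by
      have : κ ≤ (q + 1) / (96 * m) := by
        rw [le_div_iff₀ (by positivity)]
        exact hq2.le
      rw [add_div] at this
      linarith
    have hyq := hybd q (Finset.mem_range.2 hqm)
    have hy0 : 0 < y q := lt_of_lt_of_le (by norm_num) hyq
    have hs'sq : √(y q) ^ 2 = y q := Real.sq_sqrt hy0.le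
    have hcirc : κ' ^ 2 + √(y q) ^ 2 = 1 := by rw [hs'sq]; simp only [hy, hκ']; ring
    have hsge : 1 / 48 ≤ s := by nlinarith
    have hs'0 : 0 ≤ √(y q) := Real.sqrt_nonneg _
    have h1 := abs_sub_le_of_circle (c := 1) hks hcirc hκ hκ'0 (by linarith) (by linarith)
    refine ⟨κ', √(y q), hcirc, ?_, ?_⟩
    · rw [abs_of_nonneg (by linarith : (0:ℝ) ≤ κ - κ')] at h1 ⊢
      calc κ - κ' + |s - √(y q)| ≤ 1 / (96 * m) + 1 / (96 * m) := by linarith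
        _ = 1 / (24 * ((2 * m : ℕ) : ℝ)) := by push_cast; field_simp; norm_num
    · rw [hs'sq, hPe, hWe, Finset.prod_eq_zero (Finset.mem_range.2 hqm), mul_zero, abs_zero]
      · exact hB0
      · rw [inv_mul_cancel₀ hy0.ne', sub_self]
  · obtain ⟨l, hl, hlA, hls, hdist⟩ : ∃ l : ℕ, 1 ≤ l ∧ l ≤ A ∧
        ((l : ℝ) / A) ^ 2 ≤ 1 - (1 / 96) ^ 2 ∧ |s - l / A| ≤ 1 / A := by
      rcases lt_or_ge (s * A) 1 with h | h
      · refine ⟨1, le_rfl, by omega, ?_, ?_⟩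
        · have h2 : ((1 : ℕ) : ℝ) / A ≤ 1 / 2 := by
            rw [div_le_div_iff₀ hA0 (by norm_num), hAm]
            push_cast
            linarith
          have h3 : 0 ≤ ((1 : ℕ) : ℝ) / A := by positivity
          nlinarith
        · rw [abs_le]
          have : s < 1 / A := by rwa [lt_div_iff₀ hA0]
          push_cast
          constructor <;> linarith
      · have h1 : ((⌊s * A⌋₊ : ℕ) : ℝ) ≤ s * A := Nat.floor_le (by positivity)
        have h2 := Nat.lt_floor_add_one (s * A)
        have h3 : ((⌊s * A⌋₊ : ℕ) : ℝ) / A ≤ s := by rwa [div_le_iff₀ hA0]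
        have h4 : s ≤ ((⌊s * A⌋₊ : ℕ) : ℝ) / A + 1 / A := by
          rw [← add_div, le_div_iff₀ hA0]
          exact h2.le
        refine ⟨⌊s * A⌋₊, Nat.le_floor (by simpa using h), ?_, ?_, ?_⟩
        · have : ((⌊s * A⌋₊ : ℕ) : ℝ) ≤ A := by nlinarith
          exact_mod_cast this
        · calc (((⌊s * A⌋₊ : ℕ) : ℝ) / A) ^ 2 ≤ s ^ 2 := by gcongr
            _ = 1 - κ ^ 2 := by linarith
            _ ≤ 1 - (1 / 96) ^ 2 := by gcongr
        · rw [abs_le]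
          have : 0 < 1 / (A : ℝ) := by positivity
          constructor <;> linarith
    obtain ⟨hb1, hb2⟩ := ceil_node_bounds hl hlA
    set s' : ℝ := (A : ℝ) / ⌈(A : ℝ) ^ 2 / l⌉₊ with hs'
    have hs'0 : 0 ≤ s' := by positivity
    have hs'sq : s' ^ 2 ≤ 1 - (1 / 96) ^ 2 := le_trans (by gcongr) hls
    have hκ'sq : √(1 - s' ^ 2) ^ 2 = 1 - s' ^ 2 := Real.sq_sqrt (by nlinarith)
    have hκ'0 : 0 ≤ √(1 - s' ^ 2) := Real.sqrt_nonneg _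
    have hcirc : √(1 - s' ^ 2) ^ 2 + s' ^ 2 = 1 := by rw [hκ'sq]; ring
    have hs'1 : s' ≤ 1 := by nlinarith
    have h1 := abs_sub_le_of_circle (c := 192) (κ := s) (κ' := s') (s := κ)
      (s' := √(1 - s' ^ 2)) (by linarith) (by linarith) hs hs'0 (by linarith) (by linarith)
    have h2 : |s - s'| ≤ 2 / A := by
      have e : (2 : ℝ) / A = 1 / A + 1 / A := by ring
      rw [e]
      calc |s - s'| = |(s - l / A) + (l / A - s')| := by ring_nf
        _ ≤ |s - l / A| + |l / A - s'| := abs_add_le _ _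
        _ ≤ 1 / A + 1 / A := by
          gcongr
          rw [abs_le]
          have : 0 < 1 / (A : ℝ) := by positivity
          constructor <;> linarith
    refine ⟨√(1 - s' ^ 2), s', hcirc, ?_, ?_⟩
    · calc |κ - √(1 - s' ^ 2)| + |s - s'| ≤ 193 * (2 / A) := by linarith
        _ ≤ 1 / (24 * ((2 * m : ℕ) : ℝ)) := by
          rw [hAm, ← mul_div_assoc, div_le_div_iff₀ (by positivity) (by positivity)]
          push_cast
          linarith
    · rw [hPe, hWe, abs_mul]
      have h3 := hnode l hl hlA hs'sq
      have h4 : |∏ q ∈ Finset.range m, (1 - (y q)⁻¹ * s' ^ 2)| ≤ 1 := by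
        rw [Finset.abs_prod]
        refine Finset.prod_le_one (fun _ _ => abs_nonneg _) fun q hq => ?_
        have hyq := hybd q hq
        have hy0 : 0 < y q := lt_of_lt_of_le (by norm_num) hyq
        have h5 : (y q)⁻¹ * s' ^ 2 ≤ 1 := by
          rw [inv_mul_le_iff₀ hy0]
          linarith
        have h6 : 0 ≤ (y q)⁻¹ * s' ^ 2 := by positivity
        rw [abs_le]
        constructor <;> linarith
      calc _ ≤ B * 1 := by gcongr
        _ = B := mul_one B

/-! ### Well-conditioned coefficients -/

open Polynomial in
/-- Duality: a bound for extrapolation to `0` is attained by coefficients of that `ℓ¹` norm, by the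
theorem of Hahn and Banach. -/
lemma exists_extrapolation {M m : ℕ} {x : Fin M → ℝ} {c : ℝ} (hc : 0 ≤ c)
    (hx : ∀ p ∈ degreeLT ℝ m, ∀ B : ℝ, (∀ j, |p.eval (x j)| ≤ B) → 0 ≤ B → |p.eval 0| ≤ c * B) :
    ∃ a : Fin M → ℝ, ∑ j, |a j| ≤ c ∧
      ∀ p ∈ degreeLT ℝ m, ∑ j, p.eval (x j) * a j = p.eval 0 := by
  let ev : degreeLT ℝ m →ₗ[ℝ] (Fin M → ℝ) :=
    LinearMap.pi fun j => (leval (x j)).comp (degreeLT ℝ m).subtype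
  let ev₀ : degreeLT ℝ m →ₗ[ℝ] ℝ := (leval 0).comp (degreeLT ℝ m).subtype
  have hev : ∀ p j, ev p j = (p : ℝ[X]).eval (x j) := fun p j => rfl
  have hev₀ : ∀ p, ev₀ p = (p : ℝ[X]).eval 0 := fun p => rfl
  have hbound : ∀ p, |ev₀ p| ≤ c * ‖ev p‖ := fun p =>
    hx p p.2 _ (fun j => norm_le_pi_norm (ev p) j) (norm_nonneg _)
  have hker : ev₀ ∈ LinearMap.range ev.dualMap := by
    rw [LinearMap.range_dualMap_eq_dualAnnihilator_ker, Submodule.mem_dualAnnihilator]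
    intro p hp
    have := hbound p
    rw [LinearMap.mem_ker.1 hp] at this
    simpa using this
  obtain ⟨f, hf⟩ := hker
  have hf' : ∀ p, f (ev p) = ev₀ p := fun p => by rw [← hf]; rfl
  obtain ⟨g, hg, hgle⟩ := exists_extension_of_le_sublinear
    ⟨LinearMap.range ev, f.comp (LinearMap.range ev).subtype⟩ (fun v => c * ‖v‖)
    (fun r hr v => by rw [norm_smul, Real.norm_of_nonneg hr.le]; ring)
    (fun v w => by rw [← mul_add]; gcongr; exact norm_add_le _ _)
    (by
      rintro ⟨_, p, rfl⟩
      exact (le_abs_self _).trans ((congrArg abs (hf' p)).le.trans (hbound p)))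
  have hsum : ∀ v : Fin M → ℝ, g v = ∑ j, v j * g (Pi.single j 1) := by
    intro v
    conv_lhs => rw [pi_eq_sum_univ' v]
    simp [map_sum]
  refine ⟨fun j => g (Pi.single j 1), ?_, fun p hp => ?_⟩
  · calc ∑ j, |g (Pi.single j 1)|
        = g (fun j => SignType.sign (g (Pi.single j 1))) := by
          rw [hsum]
          exact Finset.sum_congr rfl fun j _ => (sign_mul_self _).symm
      _ ≤ c * ‖fun j => ((SignType.sign (g (Pi.single j 1)) : SignType) : ℝ)‖ := hgle _
      _ ≤ c * 1 := by
        gcongr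
        refine (pi_norm_le_iff_of_nonneg zero_le_one).2 fun j => ?_
        rcases SignType.sign (g (Pi.single j 1)) with _ | _ | _ <;> simp
      _ = c := mul_one c
  · have h1 := hg ⟨ev ⟨p, hp⟩, ⟨_, rfl⟩⟩
    have h2 : g (ev ⟨p, hp⟩) = p.eval 0 := h1.trans (hf' ⟨p, hp⟩)
    rw [← h2, hsum]
    rfl

lemma card_nodes_le (m : ℕ) : (nodes m).card ≤ 20000 * m := by
  refine (Finset.card_filter_le _ _).trans (Finset.card_image_le.trans ?_)
  rw [Nat.card_Icc, Nat.add_sub_cancel]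

lemma sum_nodes_le {m : ℕ} (hm : 0 < m) :
    ∑ k ∈ nodes m, (k : ℝ) ≤
      ((20000 * m : ℕ) : ℝ) ^ 2 * (2 + Real.log ((20000 * m : ℕ) : ℝ)) := by
  obtain ⟨A, hA⟩ : ∃ A : ℕ, A = 20000 * m := ⟨_, rfl⟩
  have hA1 : (1 : ℝ) ≤ A := by exact_mod_cast (show 1 ≤ A by omega)
  have hharm : ∑ l ∈ Finset.Icc 1 A, ((l : ℝ))⁻¹ ≤ 1 + Real.log A := by
    have := harmonic_le_one_add_log A
    rw [harmonic_eq_sum_Icc] at this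
    push_cast at this
    exact this
  rw [nodes, ← hA]
  calc _ ≤ ∑ k ∈ (Finset.Icc 1 A).image (fun l : ℕ => ⌈(A : ℝ) ^ 2 / l⌉₊), (k : ℝ) :=
        Finset.sum_le_sum_of_subset_of_nonneg (Finset.filter_subset _ _) fun _ _ _ => by positivity
    _ ≤ ∑ l ∈ Finset.Icc 1 A, ((⌈(A : ℝ) ^ 2 / l⌉₊ : ℕ) : ℝ) :=
        Finset.sum_image_le_of_nonneg (fun _ _ => by positivity)
    _ ≤ ∑ l ∈ Finset.Icc 1 A, ((A : ℝ) ^ 2 * (l : ℝ)⁻¹ + 1) :=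
        Finset.sum_le_sum fun l _ => by
          rw [← div_eq_mul_inv]
          exact (Nat.ceil_lt_add_one (by positivity)).le
    _ = (A : ℝ) ^ 2 * ∑ l ∈ Finset.Icc 1 A, (l : ℝ)⁻¹ + A := by
        rw [Finset.sum_add_distrib, Finset.mul_sum]
        simp
    _ ≤ (A : ℝ) ^ 2 * (1 + Real.log A) + A ^ 2 := by
        gcongr
        nlinarith
    _ = _ := by ring

/-- Well-conditioned multiproduct coefficients of every order; even `∑ j, |a j|` is bounded. -/
theorem exists_wellConditioned : ∃ K : ℝ, 0 < K ∧ ∀ m : ℕ, 2 ≤ m →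
    ∃ (M : ℕ) (k : Fin M → ℕ) (a : Fin M → ℝ), IsMultiproduct m k a ∧
      ∑ j, (k j : ℝ) ≤ K * ((m : ℝ) ^ 2 * Real.log m) ∧ ∑ j, |a j| ≤ 2 ∧ (M : ℝ) ≤ K * m := by
  have hlog2 : 0 < Real.log 2 := Real.log_pos (by norm_num)
  have hlog : 0 < Real.log 20000 := Real.log_pos (by norm_num)
  set K₁ : ℝ := (2 + Real.log 20000) / Real.log 2 + 1 with hK₁
  have hK₁1 : 1 ≤ K₁ := by
    have : 0 < (2 + Real.log 20000) / Real.log 2 := by positivity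
    linarith
  refine ⟨20000 ^ 2 * K₁, by positivity, fun m hm => ?_⟩
  have hm' : (2 : ℝ) ≤ m := by exact_mod_cast hm
  let e := (nodes m).equivFin.symm
  have hsum : ∀ f : ℕ → ℝ, ∑ j, f (e j) = ∑ k ∈ nodes m, f k := by
    intro f
    rw [e.sum_comp (fun k => f k)]
    exact (nodes m).sum_coe_sort f
  obtain ⟨a, ha, hext⟩ := exists_extrapolation (m := m) (x := fun j => (((e j : ℕ) : ℝ) ^ 2)⁻¹)
    (c := 2) (by norm_num) (fun p hp B hB _ => by
      refine abs_eval_zero_le_of_nodes (m := m) ?_ fun k hk => ?_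
      · rw [Polynomial.mem_degreeLT] at hp
        by_cases h0 : p = 0
        · simp [h0]
          omega
        · exact (Polynomial.natDegree_lt_iff_degree_lt h0).2 hp
      · have := hB (e.symm ⟨k, hk⟩)
        simpa using this)
  refine ⟨(nodes m).card, fun j => e j, a, ⟨fun j => pos_of_mem_nodes (e j).2, ?_, ?_⟩, ?_, ha, ?_⟩
  · exact Subtype.val_injective.comp e.injective
  · intro i hi
    have := hext (Polynomial.X ^ i) (by
      rw [Polynomial.mem_degreeLT, Polynomial.degree_X_pow]
      exact_mod_cast hi)
    simp only [Polynomial.eval_pow, Polynomial.eval_X, zero_pow_eq] at this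
    rw [← this]
    refine Finset.sum_congr rfl fun j _ => ?_
    rw [inv_pow, pow_mul]
  · rw [hsum (fun k => (k : ℝ))]
    refine (sum_nodes_le (by omega)).trans ?_
    have hlm : Real.log 2 ≤ Real.log m := Real.log_le_log (by norm_num) hm'
    push_cast
    rw [Real.log_mul (by norm_num) (by positivity)]
    have h1 : 2 + Real.log 20000 ≤ (2 + Real.log 20000) / Real.log 2 * Real.log m := by
      rw [div_mul_eq_mul_div, le_div_iff₀ hlog2]
      gcongr
    calc (20000 * (m : ℝ)) ^ 2 * (2 + (Real.log 20000 + Real.log m))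
        = 20000 ^ 2 * (m : ℝ) ^ 2 * ((2 + Real.log 20000) + Real.log m) := by ring
      _ ≤ 20000 ^ 2 * (m : ℝ) ^ 2 *
          ((2 + Real.log 20000) / Real.log 2 * Real.log m + Real.log m) := by gcongr
      _ = 20000 ^ 2 * K₁ * ((m : ℝ) ^ 2 * Real.log m) := by rw [hK₁]; ring
  · have h1 : ((nodes m).card : ℝ) ≤ ((20000 * m : ℕ) : ℝ) := by exact_mod_cast card_nodes_le m
    refine h1.trans ?_
    push_cast
    gcongr
    nlinarith

/-! ### Powers of symmetric power series -/

section PowerSeriesTools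

open PowerSeries

lemma coeff_self_pow {A : Type*} [Ring A] {W : A⟦X⟧} (hW : coeff 0 W = 0) (n : ℕ) :
    coeff n (W ^ n) = coeff 1 W ^ n := by
  obtain ⟨V, rfl⟩ : X ∣ W := by
    rw [X_dvd_iff, ← coeff_zero_eq_constantCoeff_apply, hW]
  have h1 : coeff 1 (X * V) = coeff 0 V := by
    simp
  have h0 : ∀ j, coeff 0 (V ^ j) = coeff 0 V ^ j := fun j => by
    simp [coeff_zero_eq_constantCoeff_apply, map_pow]
  rw [(commute_X V).symm.mul_pow, coeff_X_pow_mul', if_pos le_rfl, Nat.sub_self, h1, h0]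

section Algebraic

variable {A : Type*} [Ring A] [Algebra ℂ A]

/-- The substitution `F(s) ↦ F(c s)` for power series with coefficients in a noncommutative
algebra, `c` a scalar. -/
def scale (c : ℂ) : A⟦X⟧ →* A⟦X⟧ where
  toFun F := PowerSeries.mk fun n => c ^ n • coeff n F
  map_one' := by
    ext n
    rw [coeff_mk, coeff_one]
    split_ifs with h <;> simp [h]
  map_mul' F G := by
    ext n
    rw [coeff_mk, coeff_mul, coeff_mul, Finset.smul_sum]
    refine Finset.sum_congr rfl fun p hp => ?_
    rw [coeff_mk, coeff_mk, smul_mul_smul_comm, ← pow_add,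
      Finset.HasAntidiagonal.mem_antidiagonal.1 hp]

@[simp] lemma coeff_scale (c : ℂ) (F : A⟦X⟧) (n : ℕ) :
    coeff n (scale c F) = c ^ n • coeff n F :=
  coeff_mk n fun n => c ^ n • coeff n F

/-- The series of `s ↦ exp (s a)`. -/
def expSeries (a : A) : A⟦X⟧ := PowerSeries.mk fun n => ((n.factorial : ℂ)⁻¹) • a ^ n

@[simp] lemma coeff_expSeries (a : A) (n : ℕ) :
    coeff n (expSeries a) = ((n.factorial : ℂ)⁻¹) • a ^ n := coeff_mk _ _

lemma scale_expSeries (c : ℂ) (a : A) : scale c (expSeries a) = expSeries (c • a) := by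
  ext n
  rw [coeff_scale, coeff_expSeries, coeff_expSeries, smul_pow, smul_comm]

end Algebraic

/-- The binomial theorem in divided powers. -/
lemma sum_antidiagonal_inv_factorial_smul {𝕜 B : Type*} [Field 𝕜] [CharZero 𝕜] [Ring B]
    [Algebra 𝕜 B] {a b : B} (h : Commute a b) (n : ℕ) :
    ∑ p ∈ Finset.HasAntidiagonal.antidiagonal n,
      (((p.1.factorial : 𝕜)⁻¹) • a ^ p.1) * (((p.2.factorial : 𝕜)⁻¹) • b ^ p.2) =
      ((n.factorial : 𝕜)⁻¹) • (a + b) ^ n := by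
  rw [h.add_pow', Finset.smul_sum]
  refine Finset.sum_congr rfl fun p hp => ?_
  rw [smul_mul_smul_comm, ← Nat.cast_smul_eq_nsmul 𝕜, smul_smul]
  congr 1
  have hn := Finset.HasAntidiagonal.mem_antidiagonal.1 hp
  have hfac := Nat.add_choose_mul_factorial_mul_factorial p.1 p.2
  rw [hn, ← Nat.choose_symm_of_eq_add hn.symm] at hfac
  have hfac' : (n.choose p.1 : 𝕜) * p.1.factorial * p.2.factorial = n.factorial := by
    exact_mod_cast hfac
  have h1 : (p.1.factorial : 𝕜) ≠ 0 := by exact_mod_cast p.1.factorial_ne_zero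
  have h2 : (p.2.factorial : 𝕜) ≠ 0 := by exact_mod_cast p.2.factorial_ne_zero
  have h3 : (n.factorial : 𝕜) ≠ 0 := by exact_mod_cast n.factorial_ne_zero
  rw [← mul_inv, inv_mul_eq_div, eq_div_iff h3, inv_mul_eq_div, div_eq_iff (mul_ne_zero h1 h2),
    ← hfac', mul_assoc]

section Algebraic

variable {A : Type*} [Ring A] [Algebra ℂ A]

lemma expSeries_mul {a b : A} (h : Commute a b) :
    expSeries a * expSeries b = expSeries (a + b) := by
  ext n
  rw [coeff_mul]
  simp only [coeff_expSeries]
  exact sum_antidiagonal_inv_factorial_smul h n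

lemma expSeries_zero : expSeries (0 : A) = 1 := by
  ext n
  rw [coeff_expSeries, coeff_one]
  split_ifs with h
  · simp [h]
  · simp [zero_pow h]

lemma expSeries_neg_mul (a : A) : expSeries (-a) * expSeries a = 1 := by
  rw [expSeries_mul (Commute.neg_left rfl), neg_add_cancel, expSeries_zero]

/-- The coefficients of `Z ^ k`, where `Z` has constant term `1`, by the binomial theorem for
`1 + (Z - 1)`. -/
lemma coeff_pow_eq_sum {Z : A⟦X⟧} (hZ : coeff 0 Z = 1) (n k : ℕ) :
    coeff n (Z ^ k) = ∑ j ∈ Finset.range (n + 1), (k.choose j : ℂ) • coeff n ((Z - 1) ^ j) := by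
  have hzero : ∀ j, n < j → coeff n ((Z - 1) ^ j) = 0 := by
    intro j hj
    obtain ⟨W, hW⟩ : X ∣ Z - 1 := by
      rw [X_dvd_iff, map_sub, ← coeff_zero_eq_constantCoeff_apply, hZ]
      simp
    rw [hW, (commute_X W).symm.mul_pow, coeff_X_pow_mul', if_neg (by omega)]
  have h1 : Z ^ k = ∑ j ∈ Finset.range (k + 1), (k.choose j : ℂ) • (Z - 1) ^ j := by
    conv_lhs => rw [← sub_add_cancel Z 1]
    rw [(Commute.one_right (Z - 1)).add_pow]
    refine Finset.sum_congr rfl fun j _ => ?_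
    rw [one_pow, mul_one, Nat.cast_smul_eq_nsmul, nsmul_eq_mul, (Nat.cast_commute _ _).eq]
  rw [h1, map_sum]
  have h2 : ∀ j, coeff n ((k.choose j : ℂ) • (Z - 1) ^ j) =
      (k.choose j : ℂ) • coeff n ((Z - 1) ^ j) := fun j => rfl
  simp only [h2]
  have e1 : ∀ N, k ≤ N → n ≤ N →
      ∑ j ∈ Finset.range (k + 1), (k.choose j : ℂ) • coeff n ((Z - 1) ^ j) =
      ∑ j ∈ Finset.range (N + 1), (k.choose j : ℂ) • coeff n ((Z - 1) ^ j) := by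
    intro N hk _
    refine Finset.sum_subset (Finset.range_mono (by omega)) fun j _ hj => ?_
    rw [Nat.choose_eq_zero_of_lt (by simpa using hj)]
    simp
  have e2 : ∀ N, k ≤ N → n ≤ N →
      ∑ j ∈ Finset.range (n + 1), (k.choose j : ℂ) • coeff n ((Z - 1) ^ j) =
      ∑ j ∈ Finset.range (N + 1), (k.choose j : ℂ) • coeff n ((Z - 1) ^ j) := by
    intro N _ hn
    refine Finset.sum_subset (Finset.range_mono (by omega)) fun j _ hj => ?_
    rw [hzero j (by simpa using hj), smul_zero]
  rw [e1 (max k n) (le_max_left _ _) (le_max_right _ _),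
    e2 (max k n) (le_max_left _ _) (le_max_right _ _)]

/-- The polynomial in `k` that interpolates a functional `φ` of the `n`-th coefficient of `Z ^ k`. -/
def powPoly (Z : A⟦X⟧) (φ : A →ₗ[ℂ] ℂ) (n : ℕ) : Polynomial ℂ :=
  ∑ j ∈ Finset.range (n + 1),
    Polynomial.C ((j.factorial : ℂ)⁻¹ * φ (coeff n ((Z - 1) ^ j))) * descPochhammer ℂ j

lemma eval_powPoly {Z : A⟦X⟧} (hZ : coeff 0 Z = 1) (φ : A →ₗ[ℂ] ℂ) (n k : ℕ) :
    (powPoly Z φ n).eval (k : ℂ) = φ (coeff n (Z ^ k)) := by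
  rw [coeff_pow_eq_sum hZ, powPoly, Polynomial.eval_finsetSum, map_sum]
  refine Finset.sum_congr rfl fun j _ => ?_
  rw [Polynomial.eval_mul, Polynomial.eval_C, descPochhammer_eval_eq_descFactorial, map_smul,
    Nat.descFactorial_eq_factorial_mul_choose, smul_eq_mul]
  have : (j.factorial : ℂ) ≠ 0 := by exact_mod_cast j.factorial_ne_zero
  push_cast
  field_simp

lemma natDegree_powPoly_le (Z : A⟦X⟧) (φ : A →ₗ[ℂ] ℂ) (n : ℕ) :
    (powPoly Z φ n).natDegree ≤ n := by
  refine Polynomial.natDegree_sum_le_of_forall_le _ _ fun j hj => ?_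
  refine (Polynomial.natDegree_C_mul_le _ _).trans ?_
  rw [descPochhammer_natDegree]
  simpa [Nat.lt_succ_iff] using hj

lemma coeff_powPoly_self {Z : A⟦X⟧} (hZ : coeff 0 Z = 1) (φ : A →ₗ[ℂ] ℂ) (n : ℕ) :
    (powPoly Z φ n).coeff n = (n.factorial : ℂ)⁻¹ * φ (coeff 1 Z ^ n) := by
  rw [powPoly, Polynomial.finsetSum_coeff, Finset.sum_range_succ, Finset.sum_eq_zero, zero_add,
    Polynomial.coeff_C_mul]
  · have h1 : (descPochhammer ℂ n).coeff n = 1 := by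
      have := (monic_descPochhammer ℂ n).coeff_natDegree
      rwa [descPochhammer_natDegree] at this
    have h2 : coeff n ((Z - 1) ^ n) = coeff 1 Z ^ n := by
      rw [coeff_self_pow (by rw [map_sub, hZ]; simp), map_sub, coeff_one]
      simp
    rw [h1, h2, mul_one]
  · intro j hj
    rw [Polynomial.coeff_C_mul, Polynomial.coeff_eq_zero_of_natDegree_lt, mul_zero]
    rw [descPochhammer_natDegree]
    simpa using hj

/-- Time-reversal symmetry `Z(-s) Z(s) = 1` makes the interpolating polynomial even or odd. Both
sides are the `n`-th coefficient of `Z(-s) ^ k`: on the left as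
`Z(s) ^ l * Z(-s) ^ k = Z(s) ^ (l - k)`, an identity between polynomials in `l` that holds for `l ≥ k`
and hence for `l = 0`. -/
lemma eval_neg_powPoly {Z : A⟦X⟧} (hZ : coeff 0 Z = 1) (hrev : Z * scale (-1) Z = 1)
    (φ : A →ₗ[ℂ] ℂ) (n k : ℕ) :
    (powPoly Z φ n).eval (-(k : ℂ)) = (-1) ^ n * (powPoly Z φ n).eval (k : ℂ) := by
  have hpow : ∀ d, Z ^ (d + k) * scale (-1) Z ^ k = Z ^ d := by
    intro d
    rw [pow_add, mul_assoc]
    have : ∀ j, Z ^ j * scale (-1) Z ^ j = 1 := by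
      intro j
      induction j with
      | zero => simp
      | succ j ih =>
        rw [pow_succ, pow_succ', mul_assoc, ← mul_assoc Z, hrev, one_mul, ih]
    rw [this, mul_one]
  have hcoeffs : ∀ j, coeff j (scale (-1) Z ^ k) = (-1 : ℂ) ^ j • coeff j (Z ^ k) := by
    intro j
    rw [← map_pow, coeff_scale]
  let ψ : ℕ → A →ₗ[ℂ] ℂ := fun j => φ ∘ₗ LinearMap.mulRight ℂ (coeff j (scale (-1) Z ^ k))
  let q : Polynomial ℂ := ∑ p ∈ Finset.HasAntidiagonal.antidiagonal n, powPoly Z (ψ p.2) p.1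
  have hq : ∀ l : ℕ, q.eval (l : ℂ) = φ (coeff n (Z ^ l * scale (-1) Z ^ k)) := by
    intro l
    rw [coeff_mul, map_sum, Polynomial.eval_finsetSum]
    refine Finset.sum_congr rfl fun p _ => ?_
    rw [eval_powPoly hZ]
    rfl
  have hqp : q = (powPoly Z φ n).comp (Polynomial.X - Polynomial.C (k : ℂ)) := by
    refine Polynomial.eq_of_infinite_eval_eq _ _ ?_
    refine Set.Infinite.mono (s := Set.range fun d : ℕ => ((d + k : ℕ) : ℂ)) ?_ ?_
    · rintro _ ⟨d, rfl⟩
      simp only [Set.mem_ofPred_eq]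
      rw [hq, hpow, Polynomial.eval_comp, ← eval_powPoly hZ]
      simp
    · refine Set.infinite_range_of_injective fun d d' h => ?_
      have : d + k = d' + k := by exact_mod_cast h
      omega
  have h0 := hq 0
  rw [hqp, pow_zero, one_mul, hcoeffs, map_smul, Polynomial.eval_comp, ← eval_powPoly hZ] at h0
  simpa using h0

lemma coeff_powPoly_of_odd {Z : A⟦X⟧} (hZ : coeff 0 Z = 1) (hrev : Z * scale (-1) Z = 1)
    (φ : A →ₗ[ℂ] ℂ) {n i : ℕ} (hi : i ≤ n) (hodd : Odd (n - i)) :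
    (powPoly Z φ n).coeff i = 0 := by
  have h : (powPoly Z φ n).comp (Polynomial.C (-1) * Polynomial.X) =
      Polynomial.C ((-1) ^ n) * powPoly Z φ n := by
    refine Polynomial.eq_of_infinite_eval_eq _ _ ?_
    refine Set.Infinite.mono (s := Set.range fun d : ℕ => (d : ℂ)) ?_
      (Set.infinite_range_of_injective Nat.cast_injective)
    rintro _ ⟨d, rfl⟩
    simp only [Set.mem_ofPred_eq, Polynomial.eval_comp, Polynomial.eval_X,
      Polynomial.eval_mul, Polynomial.eval_C, neg_one_mul]
    exact eval_neg_powPoly hZ hrev φ n d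
  have h1 := congrArg (fun p => p.coeff i) h
  simp only [Polynomial.comp_C_mul_X_coeff, Polynomial.coeff_C_mul] at h1
  have h2 : (-1 : ℂ) ^ n = -(-1) ^ i := by
    have : n = i + (n - i) := by omega
    rw [this, pow_add, hodd.neg_one_pow]
    ring
  rw [h2] at h1
  have h3 : (-1 : ℂ) ^ i ≠ 0 := pow_ne_zero _ (by norm_num)
  have h4 : (2 * (-1 : ℂ) ^ i) * (powPoly Z φ n).coeff i = 0 := by linear_combination h1
  simpa [h3] using h4

/-- A multiproduct formula of order `2 m` built on a symmetric series `Z` agrees with the exponential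
of the linear term of `Z` up to degree `2 m`: the `n`-th coefficient of `Z(s / k) ^ k` is a
polynomial in `k ^ (-2)` without term of degree `m` or more. -/
lemma sum_coeff_pow_eq {Z : A⟦X⟧} (hZ : coeff 0 Z = 1) (hrev : Z * scale (-1) Z = 1)
    {m M : ℕ} {k : Fin M → ℕ} {a : Fin M → ℝ} (hka : IsMultiproduct m k a) {n : ℕ} (hm : 0 < m)
    (hn : n ≤ 2 * m) :
    ∑ j, (a j : ℂ) • coeff n (scale ((k j : ℂ)⁻¹) Z ^ k j) = coeff n (expSeries (coeff 1 Z)) := by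
  rw [← sub_eq_zero, ← Module.forall_dual_apply_eq_zero_iff ℂ]
  intro φ
  rw [map_sub, sub_eq_zero, map_sum, coeff_expSeries, map_smul, smul_eq_mul,
    ← coeff_powPoly_self hZ]
  set p := powPoly Z φ n with hp
  have hk0 : ∀ j, (k j : ℂ) ≠ 0 := fun j => by exact_mod_cast (hka.pos j).ne'
  have h1 : ∀ j, φ ((a j : ℂ) • coeff n (scale ((k j : ℂ)⁻¹) Z ^ k j)) =
      ∑ i ∈ Finset.range (n + 1), p.coeff i * ((((k j : ℂ) ^ (n - i))⁻¹) * a j) := by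
    intro j
    rw [← map_pow, coeff_scale, map_smul, map_smul, ← eval_powPoly hZ,
      Polynomial.eval_eq_sum_range' (Nat.lt_succ_of_le (natDegree_powPoly_le Z φ n)),
      Finset.smul_sum, Finset.smul_sum, ← hp]
    refine Finset.sum_congr rfl fun i hi => ?_
    have hi' : i ≤ n := by simpa [Nat.lt_succ_iff] using hi
    have : (k j : ℂ) ^ n = (k j : ℂ) ^ (n - i) * (k j : ℂ) ^ i := by
      rw [← pow_add, Nat.sub_add_cancel hi']
    rw [smul_eq_mul, smul_eq_mul, inv_pow, this]
    have := hk0 j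
    field_simp
  simp only [h1]
  rw [Finset.sum_comm, Finset.sum_range_succ]
  have hV : ∀ i, i < m → ∑ j, (((k j : ℂ) ^ (2 * i))⁻¹) * (a j : ℂ) = if i = 0 then 1 else 0 := by
    intro i hi
    have := congrArg (fun x : ℝ => (x : ℂ)) (hka.vandermonde i hi)
    push_cast at this
    rw [this]
    split_ifs <;> simp
  have hlast : ∑ j, p.coeff n * ((((k j : ℂ) ^ (n - n))⁻¹) * a j) = p.coeff n := by
    rw [← Finset.mul_sum, Nat.sub_self]
    have := hV 0 hm
    simp only [mul_zero, if_true] at this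
    rw [this, mul_one]
  rw [hlast, Finset.sum_eq_zero, zero_add]
  intro i hi
  have hi' : i < n := by simpa using hi
  rw [← Finset.mul_sum]
  rcases Nat.even_or_odd (n - i) with hev | hodd
  · obtain ⟨b, hb⟩ := hev
    rcases Nat.eq_zero_or_pos i with rfl | hipos
    · -- the constant term vanishes since `Z ^ 0 = 1`
      have h0 := eval_powPoly hZ φ n 0
      rw [pow_zero, coeff_one, if_neg (by omega), map_zero, Nat.cast_zero,
        ← Polynomial.coeff_zero_eq_eval_zero] at h0
      rw [hp, h0, zero_mul]
    · have := hV b (by omega)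
      rw [if_neg (by omega)] at this
      rw [hb, ← two_mul, this, mul_zero]
  · rw [hp, coeff_powPoly_of_odd hZ hrev φ hi'.le hodd, zero_mul]

end Algebraic

end PowerSeriesTools

/-! ### The error of multiproduct formulas -/

section MultiproductError

open PowerSeries

lemma coeff_zero_mul {A : Type*} [Ring A] (F G : A⟦X⟧) :
    coeff 0 (F * G) = coeff 0 F * coeff 0 G := by
  simp [coeff_mul]

lemma coeff_one_mul_of_coeff_zero {A : Type*} [Ring A] {F G : A⟦X⟧} (hF : coeff 0 F = 1)
    (hG : coeff 0 G = 1) : coeff 1 (F * G) = coeff 1 F + coeff 1 G := by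
  rw [coeff_mul, Finset.Nat.sum_antidiagonal_succ, Finset.Nat.antidiagonal_zero]
  simp only [Finset.sum_singleton, hF, hG, zero_add, one_mul, mul_one]
  rw [add_comm]

section Analytic

variable {A : Type*} [NormedRing A] [NormedAlgebra ℂ A]

/-- `f` is the sum of the power series `F`, whose coefficients are bounded by those of `exp (Λ s)`. -/
structure HasSeries (Λ : ℝ) (F : A⟦X⟧) (f : ℝ → A) : Prop where
  nonneg : 0 ≤ Λ
  bound : ∀ n, ‖coeff n F‖ ≤ Λ ^ n / n.factorial
  hasSum : ∀ s : ℝ, HasSum (fun n => (s : ℂ) ^ n • coeff n F) (f s)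

namespace HasSeries

variable {Λ Λ' : ℝ} {F G : A⟦X⟧} {f g : ℝ → A}

lemma norm_term_le (hF : HasSeries Λ F f) (s : ℝ) (n : ℕ) :
    ‖(s : ℂ) ^ n • coeff n F‖ ≤ (|s| * Λ) ^ n / n.factorial := by
  rw [norm_smul, norm_pow, Complex.norm_real, Real.norm_eq_abs, mul_pow, mul_div_assoc]
  gcongr
  exact hF.bound n

lemma summable_norm (hF : HasSeries Λ F f) (s : ℝ) :
    Summable fun n => ‖(s : ℂ) ^ n • coeff n F‖ :=
  (Real.summable_pow_div_factorial (|s| * Λ)).of_nonneg_of_le (fun _ => norm_nonneg _)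
    (hF.norm_term_le s)

lemma mul [CompleteSpace A] (hF : HasSeries Λ F f) (hG : HasSeries Λ' G g) :
    HasSeries (Λ + Λ') (F * G) (fun s => f s * g s) where
  nonneg := add_nonneg hF.nonneg hG.nonneg
  bound n := by
    have h := sum_antidiagonal_inv_factorial_smul (𝕜 := ℝ) (Commute.all Λ Λ') n
    simp only [smul_eq_mul] at h
    rw [div_eq_inv_mul, ← h, coeff_mul]
    refine norm_sum_le_of_le _ fun p _ => (norm_mul_le _ _).trans ?_
    rw [← div_eq_inv_mul, ← div_eq_inv_mul]
    exact mul_le_mul (hF.bound _) (hG.bound _) (norm_nonneg _)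
      (div_nonneg (pow_nonneg hF.nonneg _) (Nat.cast_nonneg _))
  hasSum s := by
    have h1 := tsum_mul_tsum_eq_tsum_sum_antidiagonal_of_summable_norm
      (hF.summable_norm s) (hG.summable_norm s)
    have h2 := (summable_norm_sum_mul_antidiagonal_of_summable_norm
      (hF.summable_norm s) (hG.summable_norm s)).of_norm.hasSum
    rw [← h1, (hF.hasSum s).tsum_eq, (hG.hasSum s).tsum_eq] at h2
    have e : ∀ n, (s : ℂ) ^ n • coeff n (F * G) =
        ∑ p ∈ Finset.HasAntidiagonal.antidiagonal n,
          ((s : ℂ) ^ p.1 • coeff p.1 F) * ((s : ℂ) ^ p.2 • coeff p.2 G) := by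
      intro n
      rw [coeff_mul, Finset.smul_sum]
      refine Finset.sum_congr rfl fun p hp => ?_
      rw [smul_mul_smul_comm, ← pow_add, Finset.HasAntidiagonal.mem_antidiagonal.1 hp]
    simpa only [e] using h2

lemma one [NormOneClass A] : HasSeries 0 (1 : A⟦X⟧) fun _ => 1 where
  nonneg := le_rfl
  bound n := by
    rw [coeff_one]
    split_ifs with h
    · simp [h]
    · simp [zero_pow h]
  hasSum s := by
    convert hasSum_single (f := fun n => (s : ℂ) ^ n • coeff n (1 : A⟦X⟧)) 0 ?_ using 1
    · simp
    · intro n hn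
      rw [coeff_one, if_neg hn, smul_zero]

lemma pow [CompleteSpace A] [NormOneClass A] (hF : HasSeries Λ F f) (k : ℕ) :
    HasSeries (k * Λ) (F ^ k) fun s => f s ^ k := by
  induction k with
  | zero => simpa using one
  | succ k ih =>
    simp only [pow_succ]
    convert ih.mul hF using 1
    push_cast
    ring

lemma scale (hF : HasSeries Λ F f) (c : ℝ) :
    HasSeries (|c| * Λ) (scale (c : ℂ) F) fun s => f (s * c) where
  nonneg := mul_nonneg (abs_nonneg _) hF.nonneg
  bound n := by
    rw [coeff_scale]
    exact hF.norm_term_le c n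
  hasSum s := by
    convert hF.hasSum (s * c) using 2 with n
    rw [coeff_scale, smul_smul, ← mul_pow]
    push_cast
    rfl

end HasSeries

lemma hasSeries_exp [CompleteSpace A] [NormOneClass A] (a : A) :
    HasSeries ‖a‖ (expSeries a) fun s => NormedSpace.exp ((s : ℂ) • a) where
  nonneg := norm_nonneg _
  bound n := by
    rw [coeff_expSeries, norm_smul, norm_inv, Complex.norm_natCast, div_eq_inv_mul]
    gcongr
    exact norm_pow_le _ _
  hasSum s := by
    have := NormedSpace.exp_series_hasSum_exp' (𝕂 := ℂ) ((s : ℂ) • a)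
    convert this using 2 with n
    rw [coeff_expSeries, smul_pow, smul_comm]

/-- A remainder estimate for a combination of functions whose series agrees with that of `g` in
degrees below `N`. -/
lemma norm_sum_smul_sub_le {Λ s : ℝ} {M N : ℕ} {F : Fin M → A⟦X⟧} {f : Fin M → ℝ → A}
    {G : A⟦X⟧} {g : ℝ → A} (a : Fin M → ℝ) (hF : ∀ j, HasSeries Λ (F j) (f j))
    (hG : HasSeries Λ G g) (h : ∀ n < N, ∑ j, (a j : ℂ) • coeff n (F j) = coeff n G)
    (hs : |s| * Λ ≤ 1) :
    ‖∑ j, (a j : ℂ) • f j s - g s‖ ≤ (∑ j, |a j| + 1) * (3 / N.factorial) := by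
  have hΛ := hG.nonneg
  set d : ℕ → A := fun n => (∑ j, (a j : ℂ) • ((s : ℂ) ^ n • coeff n (F j))) -
    (s : ℂ) ^ n • coeff n G with hd
  have hsum : HasSum d (∑ j, (a j : ℂ) • f j s - g s) :=
    (hasSum_sum fun j _ => ((hF j).hasSum s).const_smul _).sub (hG.hasSum s)
  have hd0 : ∀ n ∈ Finset.range N, d n = 0 := by
    intro n hn
    simp only [hd]
    rw [← h n (Finset.mem_range.1 hn), Finset.smul_sum, sub_eq_zero]
    exact Finset.sum_congr rfl fun j _ => smul_comm _ _ _
  have hle : ∀ x : ℝ, 0 ≤ x → x ≤ 1 → ∀ n, x ^ n / n.factorial ≤ 1 / n.factorial := by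
    intro x hx0 hx1 n
    gcongr
    exact pow_le_one₀ hx0 hx1
  have hterm : ∀ n, ‖d n‖ ≤ (∑ j, |a j| + 1) * (1 / n.factorial) := by
    intro n
    have h1 := fun j => ((hF j).norm_term_le s n).trans (hle _ (by positivity) hs n)
    have h2 := (hG.norm_term_le s n).trans (hle _ (by positivity) hs n)
    refine (norm_sub_le _ _).trans ?_
    rw [add_mul, one_mul, Finset.sum_mul]
    refine add_le_add (norm_sum_le_of_le _ fun j _ => ?_) h2
    rw [norm_smul, Complex.norm_real, Real.norm_eq_abs]
    gcongr
    exact h1 j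
  have hshift : HasSum (fun n => d (n + N)) (∑ j, (a j : ℂ) • f j s - g s) := by
    rw [hasSum_nat_add_iff, Finset.sum_eq_zero hd0, add_zero]
    exact hsum
  set S : ℝ := ∑ j, |a j| + 1 with hS
  have hS0 : 0 ≤ S := by positivity
  have hexp : HasSum (fun n : ℕ => S * (1 / N.factorial) * (1 / (n.factorial : ℝ)))
      (S * (1 / N.factorial) * Real.exp 1) := by
    have := (NormedSpace.exp_series_hasSum_exp' (𝕂 := ℝ) (1 : ℝ)).mul_left
      (S * (1 / (N.factorial : ℝ)))
    rw [← Real.exp_eq_exp_ℝ] at this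
    simpa using this
  have hfin : ‖∑ j, (a j : ℂ) • f j s - g s‖ ≤ S * (1 / N.factorial) * Real.exp 1 := by
    refine hshift.norm_le_of_bounded hexp fun n => ?_
    refine (hterm _).trans ?_
    rw [mul_assoc, one_div_mul_one_div]
    gcongr
    have : N.factorial * n.factorial ≤ (n + N).factorial := by
      rw [mul_comm]
      exact Nat.le_of_dvd (Nat.factorial_pos _) (Nat.factorial_mul_factorial_dvd_factorial_add n N)
    exact_mod_cast this
  refine hfin.trans ?_
  rw [mul_assoc]
  gcongr
  rw [one_div_mul_eq_div]
  gcongr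
  exact Real.exp_one_lt_three.le

end Analytic

section Formula

variable {E : Type*} [NormedAddCommGroup E] [InnerProductSpace ℂ E]

/-- The series of a product of evolutions. -/
def prodSeries (l : List (E →L[ℂ] E)) : (E →L[ℂ] E)⟦X⟧ :=
  (l.map fun a => expSeries (-Complex.I • a)).prod

lemma hasSeries_evolution [CompleteSpace E] [Nontrivial E] (a : E →L[ℂ] E) :
    HasSeries ‖a‖ (expSeries (-Complex.I • a)) (evolution a) := by
  convert hasSeries_exp (-Complex.I • a) using 1
  · simp [norm_smul]
  · ext1 s
    rw [evolution, smul_smul, mul_comm]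

lemma hasSeries_prodSeries [CompleteSpace E] [Nontrivial E] (l : List (E →L[ℂ] E)) :
    HasSeries (l.map norm).sum (prodSeries l) fun s => (l.map fun a => evolution a s).prod := by
  induction l with
  | nil => simpa [prodSeries] using HasSeries.one
  | cons a l ih => simpa [prodSeries] using (hasSeries_evolution a).mul ih

lemma coeff_zero_prodSeries (l : List (E →L[ℂ] E)) : coeff 0 (prodSeries l) = 1 := by
  induction l with
  | nil => simp [prodSeries]
  | cons a l ih =>
    rw [prodSeries, List.map_cons, List.prod_cons, ← prodSeries, coeff_zero_mul, ih]
    simp [-coeff_zero_eq_constantCoeff]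

lemma coeff_one_prodSeries (l : List (E →L[ℂ] E)) :
    coeff 1 (prodSeries l) = -Complex.I • l.sum := by
  induction l with
  | nil => simp [prodSeries, coeff_one]
  | cons a l ih =>
    rw [prodSeries, List.map_cons, List.prod_cons, ← prodSeries,
      coeff_one_mul_of_coeff_zero (by simp) (coeff_zero_prodSeries l), ih, List.sum_cons,
      smul_add]
    simp

lemma prodSeries_reverse_mul (l : List (E →L[ℂ] E)) :
    prodSeries l * scale (-1) (prodSeries l.reverse) = 1 := by
  induction l with
  | nil => simp [prodSeries]
  | cons a l ih =>
    have h : prodSeries (a :: l).reverse = prodSeries l.reverse * expSeries (-Complex.I • a) := by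
      simp [prodSeries]
    have h' : prodSeries (a :: l) = expSeries (-Complex.I • a) * prodSeries l := by
      simp [prodSeries]
    rw [h, h', map_mul, mul_assoc, ← mul_assoc (prodSeries l), ih, one_mul, scale_expSeries,
      neg_one_smul]
    simpa using expSeries_neg_mul (-(-Complex.I • a))

/-- The power series of `U₂`. -/
def U2Series {N : ℕ} (h : Fin N → E →L[ℂ] E) : (E →L[ℂ] E)⟦X⟧ :=
  scale (1 / 2) (prodSeries (List.ofFn h) * prodSeries (List.ofFn h).reverse)

lemma hasSeries_U2 [CompleteSpace E] [Nontrivial E] {N : ℕ} (h : Fin N → E →L[ℂ] E) :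
    HasSeries (lam h) (U2Series h) (U2 h) := by
  have h1 := ((hasSeries_prodSeries (List.ofFn h)).mul
    (hasSeries_prodSeries (List.ofFn h).reverse)).scale (1 / 2)
  have hl : ((List.ofFn h).map norm).sum = lam h := by
    rw [List.map_ofFn, List.sum_ofFn]
    rfl
  rw [List.map_reverse, List.sum_reverse, hl] at h1
  convert h1 using 1
  · rw [abs_of_pos (by norm_num)]
    ring
  · rw [U2Series]
    norm_num
  · ext1 s
    rw [U2, forwardU1, backwardU1]
    simp only [List.map_reverse, List.map_ofFn, Function.comp_def, div_eq_mul_inv, one_mul]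

lemma coeff_zero_U2Series {N : ℕ} (h : Fin N → E →L[ℂ] E) : coeff 0 (U2Series h) = 1 := by
  rw [U2Series, coeff_scale, coeff_zero_mul, coeff_zero_prodSeries, coeff_zero_prodSeries,
    pow_zero, one_smul, one_mul]

lemma coeff_one_U2Series {N : ℕ} (h : Fin N → E →L[ℂ] E) :
    coeff 1 (U2Series h) = -Complex.I • hamiltonian h := by
  have h1 : (List.ofFn h).sum = hamiltonian h := List.sum_ofFn
  rw [U2Series, coeff_scale, coeff_one_mul_of_coeff_zero (coeff_zero_prodSeries (List.ofFn h))
    (coeff_zero_prodSeries (List.ofFn h).reverse), coeff_one_prodSeries, coeff_one_prodSeries,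
    List.sum_reverse, h1, ← smul_add, pow_one, ← two_smul ℂ (hamiltonian h), smul_smul, smul_smul]
  congr 1
  ring

lemma U2Series_mul_scale {N : ℕ} (h : Fin N → E →L[ℂ] E) :
    U2Series h * scale (-1) (U2Series h) = 1 := by
  have hcomm : ∀ F : (E →L[ℂ] E)⟦X⟧, scale (-1) (scale (1 / 2) F) = scale (1 / 2) (scale (-1) F) := by
    intro F
    ext1 n
    simp only [coeff_scale]
    exact smul_comm _ _ _
  set l := List.ofFn h
  have h1 := prodSeries_reverse_mul l
  have h2 := prodSeries_reverse_mul l.reverse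
  rw [List.reverse_reverse] at h2
  rw [U2Series, hcomm, ← map_mul, map_mul (scale (-1)), mul_assoc,
    ← mul_assoc (prodSeries l.reverse), h2, one_mul, h1, map_one]

lemma lam_nonneg {N : ℕ} (h : Fin N → E →L[ℂ] E) : 0 ≤ lam h :=
  Finset.sum_nonneg fun _ _ => norm_nonneg _

lemma HasSeries.mono {A : Type*} [NormedRing A] [NormedAlgebra ℂ A] {Λ Λ' : ℝ} {F : A⟦X⟧}
    {f : ℝ → A} (hF : HasSeries Λ F f) (h : Λ ≤ Λ') : HasSeries Λ' F f where
  nonneg := hF.nonneg.trans h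
  bound n := (hF.bound n).trans (by have := hF.nonneg; gcongr)
  hasSum := hF.hasSum

/-- The error of a multiproduct formula over a short time. -/
theorem norm_multiproduct_sub_evolution_le [CompleteSpace E] [Nontrivial E] {N m M : ℕ}
    (h : Fin N → E →L[ℂ] E) {k : Fin M → ℕ} {a : Fin M → ℝ} (hm : 0 < m)
    (hka : IsMultiproduct m k a) {s : ℝ}
    (hs : |s| * lam h ≤ 1) :
    ‖multiproduct h k a s - evolution (hamiltonian h) s‖ ≤
      (∑ j, |a j| + 1) * (3 / (2 * m + 1).factorial) := by
  have hF : ∀ j, HasSeries (lam h) (scale ((k j : ℂ)⁻¹) (U2Series h) ^ k j)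
      (fun s => U2 h (s / (k j : ℝ)) ^ k j) := by
    intro j
    have hk : (0 : ℝ) < k j := by exact_mod_cast hka.pos j
    have h1 := ((hasSeries_U2 h).scale ((k j : ℝ)⁻¹)).pow (k j)
    convert h1 using 1
    · rw [abs_of_pos (by positivity)]
      field_simp
    · push_cast
      rfl
    · simp only [div_eq_mul_inv]
  have hG : HasSeries (lam h) (expSeries (-Complex.I • hamiltonian h))
      (evolution (hamiltonian h)) :=
    (hasSeries_evolution _).mono (norm_sum_le _ _)
  have hcoeff : ∀ n < 2 * m + 1, ∑ j, (a j : ℂ) • coeff n (scale ((k j : ℂ)⁻¹) (U2Series h) ^ k j) =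
      coeff n (expSeries (-Complex.I • hamiltonian h)) := by
    intro n hn
    have h1 := sum_coeff_pow_eq (coeff_zero_U2Series h) (U2Series_mul_scale h) hka (n := n) hm
      (by omega)
    rw [coeff_one_U2Series] at h1
    exact h1
  have h2 := norm_sum_smul_sub_le (N := 2 * m + 1) a hF hG hcoeff hs
  exact h2

end Formula

end MultiproductError

/-! ### Circuits on one-hot states -/

section Circuits

/-- The instruction touches only ancilla qubits in `S`. -/
def Instr.SupportedOn {n : ℕ} (S : Set (Fin n)) : Instr n → Prop
  | .gate1 q _ => q ∈ S
  | .gate2 p q _ _ => p ∈ S ∧ q ∈ S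
  | .query q _ => q ∈ S

lemma Instr.SupportedOn.mono {n : ℕ} {S S' : Set (Fin n)} (h : S ⊆ S') {g : Instr n}
    (hg : g.SupportedOn S) : g.SupportedOn S' := by
  cases g with
  | gate1 q u => exact h hg
  | gate2 p q hpq u => exact ⟨h hg.1, h hg.2⟩
  | query q s => exact h hg

lemma Circuit.gateCount_append {n : ℕ} (C C' : Circuit n) :
    Circuit.gateCount (C ++ C') = Circuit.gateCount C + Circuit.gateCount C' := by
  induction C with
  | nil => simp [Circuit.gateCount]
  | cons g C ih => cases g <;> (simp [Circuit.gateCount, ih]; try omega)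

lemma Circuit.queryCount_append {n : ℕ} (C C' : Circuit n) :
    Circuit.queryCount (C ++ C') = Circuit.queryCount C + Circuit.queryCount C' := by
  induction C with
  | nil => simp [Circuit.queryCount]
  | cons g C ih => cases g <;> (simp [Circuit.queryCount, ih]; try omega)

variable {E : Type*} [NormedAddCommGroup E] [InnerProductSpace ℂ E] [CompleteSpace E]
variable {n N : ℕ} (h : Fin N → E →L[ℂ] E)

lemma Circuit.eval_append (C C' : Circuit n) :
    Circuit.eval h (C ++ C') = Circuit.eval h C' * Circuit.eval h C := by
  induction C with
  | nil => simp [Circuit.eval]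
  | cons g C ih => simp only [List.cons_append, Circuit.eval, ih, mul_assoc]

lemma Circuit.eval_singleton (g : Instr n) : Circuit.eval h [g] = g.eval h := by
  simp [Circuit.eval]

/-- A circuit does not change qubits that it does not touch. -/
lemma Circuit.eval_eq_zero {S : Set (Fin n)} {C : Circuit n} (hC : ∀ g ∈ C, g.SupportedOn S)
    {x y : Fin n → Bool} {q : Fin n} (hq : q ∉ S) (hxy : x q ≠ y q) :
    Circuit.eval h C x y = 0 := by
  have single : ∀ (g : Instr n), g.SupportedOn S → ∀ {x y : Fin n → Bool}, x q ≠ y q →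
      g.eval h x y = 0 := by
    intro g hg x y hxy
    cases g with
    | gate1 p u =>
      have : p ∈ S := hg
      simp only [Instr.eval, Matrix.map_apply, gate1Matrix, Matrix.of_apply]
      rw [if_neg, zero_smul]
      exact fun H => hxy (H q (by rintro rfl; exact hq this))
    | gate2 p p' hp u =>
      simp only [Instr.eval, Matrix.map_apply, gate2Matrix, Matrix.of_apply]
      rw [if_neg, zero_smul]
      exact fun H => hxy (H q (by rintro rfl; exact hq hg.1) (by rintro rfl; exact hq hg.2))
    | query p s =>
      simp only [Instr.eval]
      rw [Matrix.diagonal_apply_ne]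
      rintro rfl
      exact hxy rfl
  induction C generalizing x y with
  | nil =>
    simp only [Circuit.eval]
    rw [Matrix.one_apply_ne]
    rintro rfl
    exact hxy rfl
  | cons g C ih =>
    rw [Circuit.eval, Matrix.mul_apply]
    refine Finset.sum_eq_zero fun z _ => ?_
    by_cases hz : x q = z q
    · rw [single g (hC g (by simp)) (by rwa [← hz]), mul_zero]
    · rw [ih (fun g' hg' => hC g' (by simp [hg'])) hz, zero_mul]

/-- Circuits on disjoint sets of ancilla qubits succeed independently. -/
lemma Circuit.successOp_append {S S' : Set (Fin n)} (hS : Disjoint S S') {C C' : Circuit n}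
    (hC : ∀ g ∈ C, g.SupportedOn S) (hC' : ∀ g ∈ C', g.SupportedOn S') :
    Circuit.successOp h (C ++ C') = Circuit.successOp h C' * Circuit.successOp h C := by
  rw [Circuit.successOp, Circuit.eval_append, Matrix.mul_apply,
    Finset.sum_eq_single (fun _ => false)]
  · rfl
  · intro z _ hz
    obtain ⟨q, hq⟩ := Function.ne_iff.1 hz
    by_cases hqS : q ∈ S
    · rw [Circuit.eval_eq_zero h hC' (Set.disjoint_left.1 hS hqS) (Ne.symm hq), zero_mul]
    · rw [Circuit.eval_eq_zero h hC hqS hq, mul_zero]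
  · simp

variable {κ : Type*} [Fintype κ] [DecidableEq κ]

/-- The computational basis state with a single `1`, at the qubit `ι j` of the register
`ι : κ ↪ Fin n`. -/
def oneHot (ι : κ ↪ Fin n) (j : κ) : Fin n → Bool := fun q => decide (q = ι j)

omit [Fintype κ] in
lemma oneHot_injective (ι : κ ↪ Fin n) : Function.Injective (oneHot ι) := by
  intro i j hij
  have := congrFun hij (ι i)
  simpa [oneHot] using this

/-- Some circuit on the register `ι` preserves the span of the one-hot states and acts on it by
the matrix `T` with operator entries; it contains at most `g` gates and `Q` queries, all for times
with the property `P`. -/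
def Implementable (ι : κ ↪ Fin n) (P : ℝ → Prop) (g Q : ℕ) (T : Matrix κ κ (E →L[ℂ] E)) : Prop :=
  ∃ C : Circuit n, (∀ x ∈ C, x.SupportedOn (Set.range ι)) ∧ (∀ q s, Instr.query q s ∈ C → P s) ∧
    Circuit.gateCount C ≤ g ∧ Circuit.queryCount C ≤ Q ∧
    ∀ j x, Circuit.eval h C x (oneHot ι j) = ∑ l, if x = oneHot ι l then T l j else 0

namespace Implementable

variable {h} {ι : κ ↪ Fin n} {P : ℝ → Prop} {g g' Q Q' : ℕ} {T T' : Matrix κ κ (E →L[ℂ] E)}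

omit [DecidableEq κ] in
lemma mono (hT : Implementable h ι P g Q T) (hg : g ≤ g') (hQ : Q ≤ Q') :
    Implementable h ι P g' Q' T := by
  obtain ⟨C, h1, h2, h3, h4, h5⟩ := hT
  exact ⟨C, h1, h2, h3.trans hg, h4.trans hQ, h5⟩

omit [DecidableEq κ] in
/-- The circuit for `T'` is executed after the one for `T`. -/
lemma mul (hT' : Implementable h ι P g' Q' T') (hT : Implementable h ι P g Q T) :
    Implementable h ι P (g' + g) (Q' + Q) (T' * T) := by
  obtain ⟨C, h1, h2, h3, h4, h5⟩ := hT
  obtain ⟨C', h1', h2', h3', h4', h5'⟩ := hT'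
  refine ⟨C ++ C', ?_, ?_, ?_, ?_, ?_⟩
  · intro x hx
    rcases List.mem_append.1 hx with hx | hx
    exacts [h1 x hx, h1' x hx]
  · intro q s hx
    rcases List.mem_append.1 hx with hx | hx
    exacts [h2 q s hx, h2' q s hx]
  · rw [Circuit.gateCount_append]
    omega
  · rw [Circuit.queryCount_append]
    omega
  · intro j x
    rw [Circuit.eval_append, Matrix.mul_apply]
    simp only [h5, Finset.mul_sum, mul_ite, mul_zero]
    rw [Finset.sum_comm]
    simp only [Finset.sum_ite_eq', Finset.mem_univ, if_true, h5', Finset.sum_mul, ite_mul,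
      zero_mul]
    rw [Finset.sum_comm]
    refine Finset.sum_congr rfl fun l _ => ?_
    split_ifs
    · rw [Matrix.mul_apply]
    · simp

lemma one : Implementable h ι P 0 0 (1 : Matrix κ κ (E →L[ℂ] E)) := by
  refine ⟨[], by simp, by simp, by simp [Circuit.gateCount], by simp [Circuit.queryCount], ?_⟩
  intro j x
  rw [Finset.sum_eq_single j]
  · rw [Matrix.one_apply_eq, Circuit.eval, Matrix.one_apply]
  · intro l _ hl
    rw [Matrix.one_apply_ne hl, ite_self]
  · simp

/-- An instruction whose operator is diagonal in the computational basis of the ancilla qubits. -/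
lemma of_diagonal {x : Instr n} {D : (Fin n → Bool) → E →L[ℂ] E}
    (hx : x.SupportedOn (Set.range ι)) (hP : ∀ q s, x = Instr.query q s → P s)
    (hg : Circuit.gateCount [x] ≤ g) (hQ : Circuit.queryCount [x] ≤ Q)
    (hD : x.eval h = Matrix.diagonal D) :
    Implementable h ι P g Q (Matrix.diagonal fun l => D (oneHot ι l)) := by
  refine ⟨[x], by simpa using hx, ?_, hg, hQ, ?_⟩
  · intro q s hq
    exact hP q s (by simpa using Eq.symm (List.mem_singleton.1 hq))
  · intro j y
    rw [Circuit.eval_singleton, hD, Finset.sum_eq_single j]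
    · rw [Matrix.diagonal_apply_eq, Matrix.diagonal_apply]
      split_ifs with e
      · rw [e]
      · rfl
    · intro l _ hl
      rw [Matrix.diagonal_apply_ne _ hl, ite_self]
    · simp

/-- A query controlled by the qubit `ι i`. -/
lemma query (i : κ) {s : ℝ} (hs : P s) :
    Implementable h ι P 0 1 (Matrix.diagonal fun l => if l = i then U2 h s else 1) := by
  have := of_diagonal (h := h) (ι := ι) (P := P) (g := 0) (Q := 1) (x := Instr.query (ι i) s)
    (D := fun x => if x (ι i) = true then U2 h s else 1) ⟨i, rfl⟩
    (by rintro q s' ⟨⟩; exact hs) (by simp [Circuit.gateCount]) (by simp [Circuit.queryCount]) rfl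
  convert this using 3 with l
  simp [oneHot, eq_comm]

/-- The Pauli `Z` gate on the qubit `ι r` is the reflection that negates the one-hot state
of `r`. -/
lemma pauliZ (r : κ) :
    Implementable h ι P 1 0 (Matrix.diagonal fun l => if l = r then -1 else 1) := by
  let z : Bool → ℂ := fun b => if b then -1 else 1
  have hz : Matrix.diagonal z ∈ Matrix.unitaryGroup Bool ℂ := by
    rw [Matrix.mem_unitaryGroup_iff, Matrix.star_eq_conjTranspose, Matrix.diagonal_conjTranspose,
      Matrix.diagonal_mul_diagonal, ← Matrix.diagonal_one]
    congr 1
    ext b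
    cases b <;> simp [z]
  have := of_diagonal (h := h) (ι := ι) (P := P) (g := 1) (Q := 0)
    (x := Instr.gate1 (ι r) ⟨Matrix.diagonal z, hz⟩)
    (D := fun x => z (x (ι r)) • (1 : E →L[ℂ] E)) ⟨r, rfl⟩
    (by rintro q s' ⟨⟩) (by simp [Circuit.gateCount]) (by simp [Circuit.queryCount]) (by
      ext1 x y
      simp only [Instr.eval, Matrix.map_apply, gate1Matrix, Matrix.of_apply]
      by_cases hxy : x = y
      · subst hxy
        simp
      · rw [Matrix.diagonal_apply_ne _ hxy]
        split_ifs with H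
        · rw [Matrix.diagonal_apply_ne, zero_smul]
          intro hr
          refine hxy (funext fun i => ?_)
          by_cases hi : i = ι r
          · rw [hi, hr]
          · exact H i hi
        · rw [zero_smul])
  convert this using 3 with l
  by_cases hl : l = r
  · simp [oneHot, z, hl]
  · simp [oneHot, z, hl, Ne.symm hl]

end Implementable

end Circuits

/-! ### State preparation by two-level reflections -/

section Reflections

variable {κ : Type*} [DecidableEq κ]

/-- The two-level matrix `[[c, s], [s, -c]]` in the coordinates `r` and `j`. -/
def reflMatrix (r j : κ) (c s : ℝ) : Matrix κ κ ℝ :=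
  Matrix.of fun i l =>
    if i = r then (if l = r then c else if l = j then s else 0)
    else if i = j then (if l = r then s else if l = j then -c else 0)
    else if i = l then 1 else 0

lemma reflMatrix_transpose (r j : κ) (c s : ℝ) :
    (reflMatrix r j c s).transpose = reflMatrix r j c s := by
  ext i l
  simp only [reflMatrix, Matrix.transpose_apply, Matrix.of_apply]
  grind

variable [Fintype κ]

lemma sum_two_level {B : Type*} [AddCommMonoid B] {r j : κ} (hj : j ≠ r) {f : κ → B}
    (hf : ∀ i, i ≠ r → i ≠ j → f i = 0) : ∑ i, f i = f r + f j := by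
  rw [← Finset.sum_pair hj.symm]
  refine (Finset.sum_subset (Finset.subset_univ _) fun i _ hi => hf i ?_ ?_).symm <;>
  · rintro rfl
    simp at hi

lemma reflMatrix_mulVec {r j : κ} (hj : j ≠ r) (c s : ℝ) (v : κ → ℝ) (i : κ) :
    (reflMatrix r j c s).mulVec v i =
      if i = r then c * v r + s * v j else if i = j then s * v r - c * v j else v i := by
  rw [Matrix.mulVec, dotProduct]
  split_ifs with h1 h2
  · rw [sum_two_level hj]
    · simp [reflMatrix, h1, hj]
    · intro l h3 h4
      simp [reflMatrix, h1, h3, h4]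
  · rw [sum_two_level hj]
    · simp [reflMatrix, h2, hj, sub_eq_add_neg]
    · intro l h3 h4
      simp [reflMatrix, h2, hj, h3, h4]
  · rw [Finset.sum_eq_single i]
    · simp [reflMatrix, h1, h2]
    · intro l _ h3
      simp [reflMatrix, h1, h2, Ne.symm h3]
    · simp

lemma reflMatrix_mul_self {r j : κ} (hj : j ≠ r) {c s : ℝ} (hcs : c ^ 2 + s ^ 2 = 1) :
    reflMatrix r j c s * reflMatrix r j c s = 1 := by
  refine Matrix.mulVec_injective (funext fun v => funext fun i => ?_)
  rw [← Matrix.mulVec_mulVec, Matrix.one_mulVec, reflMatrix_mulVec hj, reflMatrix_mulVec hj,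
    reflMatrix_mulVec hj]
  simp only [if_true, if_neg hj]
  split_ifs with h1 h2
  · rw [h1]
    linear_combination v r * hcs
  · rw [h2]
    linear_combination v j * hcs
  · rw [reflMatrix_mulVec hj, if_neg h1, if_neg h2]

/-- Products of `g` two-level reflections that involve the coordinate `r`. -/
inductive IsReflProduct (r : κ) : ℕ → Matrix κ κ ℝ → Prop
  | one : IsReflProduct r 0 1
  | mul {g : ℕ} {R : Matrix κ κ ℝ} {j : κ} {c s : ℝ} (hj : j ≠ r) (hcs : c ^ 2 + s ^ 2 = 1)
      (hR : IsReflProduct r g R) : IsReflProduct r (g + 1) (reflMatrix r j c s * R)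

lemma IsReflProduct.transpose_mul {r : κ} {g : ℕ} {R : Matrix κ κ ℝ} (hR : IsReflProduct r g R) :
    R.transpose * R = 1 := by
  induction hR with
  | one => simp
  | @mul g R j c s hj hcs hR ih =>
    rw [Matrix.transpose_mul, reflMatrix_transpose, Matrix.mul_assoc,
      ← Matrix.mul_assoc (reflMatrix r j c s), reflMatrix_mul_self hj hcs, Matrix.one_mul, ih]

lemma IsReflProduct.mul_transpose {r : κ} {g : ℕ} {R : Matrix κ κ ℝ} (hR : IsReflProduct r g R) :
    R * R.transpose = 1 :=
  mul_eq_one_comm.1 hR.transpose_mul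

/-- Givens elimination of the coordinates in `S`, one reflection for each. -/
lemma exists_isReflProduct_eliminate (r : κ) (v : κ → ℝ) (S : Finset κ) (hS : r ∉ S) :
    ∃ R, IsReflProduct r S.card R ∧ (∀ i ∈ S, R.mulVec v i = 0) ∧
      (∀ i, i ≠ r → i ∉ S → R.mulVec v i = v i) ∧ (S.Nonempty → 0 ≤ R.mulVec v r) := by
  induction S using Finset.induction_on with
  | empty => exact ⟨1, .one, by simp, by simp, by simp⟩
  | @insert j S hjS ih =>
    obtain ⟨R, hR, h0, h1, -⟩ := ih (fun h => hS (Finset.mem_insert_of_mem h))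
    have hj : j ≠ r := by
      rintro rfl
      simp at hS
    set w := R.mulVec v with hw
    obtain ⟨c, s, hcs, hr, hz⟩ : ∃ c s : ℝ, c ^ 2 + s ^ 2 = 1 ∧ 0 ≤ c * w r + s * w j ∧
        s * w r - c * w j = 0 := by
      have hsq : √(w r ^ 2 + w j ^ 2) ^ 2 = w r ^ 2 + w j ^ 2 := Real.sq_sqrt (by positivity)
      rcases (Real.sqrt_nonneg (w r ^ 2 + w j ^ 2)).eq_or_lt with h | h
      · rw [← h] at hsq
        have hwr : w r = 0 := by nlinarith [sq_nonneg (w r), sq_nonneg (w j)]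
        have hwj : w j = 0 := by nlinarith [sq_nonneg (w r), sq_nonneg (w j)]
        exact ⟨1, 0, by norm_num, by simp [hwr], by simp [hwj]⟩
      · refine ⟨w r / √(w r ^ 2 + w j ^ 2), w j / √(w r ^ 2 + w j ^ 2), ?_, ?_, ?_⟩
        · rw [div_pow, div_pow, ← add_div, hsq, div_self]
          rw [← hsq]
          positivity
        · have : w r / √(w r ^ 2 + w j ^ 2) * w r + w j / √(w r ^ 2 + w j ^ 2) * w j =
              (w r ^ 2 + w j ^ 2) / √(w r ^ 2 + w j ^ 2) := by ring
          rw [this]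
          positivity
        · ring
    refine ⟨reflMatrix r j c s * R, ?_, ?_, ?_, ?_⟩
    · rw [Finset.card_insert_of_notMem hjS]
      exact .mul hj hcs hR
    · intro i hi
      rw [← Matrix.mulVec_mulVec, reflMatrix_mulVec hj, ← hw]
      have hir : i ≠ r := by
        rintro rfl
        exact hS hi
      rw [if_neg hir]
      rcases Finset.mem_insert.1 hi with rfl | hi'
      · rw [if_pos rfl, hz]
      · rw [if_neg (by rintro rfl; exact hjS hi'), h0 i hi']
    · intro i hir hi
      rw [← Matrix.mulVec_mulVec, reflMatrix_mulVec hj, ← hw, if_neg hir,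
        if_neg (by rintro rfl; simp at hi)]
      exact h1 i hir fun h => hi (Finset.mem_insert_of_mem h)
    · intro _
      rw [← Matrix.mulVec_mulVec, reflMatrix_mulVec hj, if_pos rfl, ← hw]
      exact hr

/-- State preparation: a real unit vector is the image of the basis vector at `r` under the
transpose of a product of reflections. -/
lemma exists_isReflProduct_row (r : κ) (hκ : 1 < Fintype.card κ) (v : κ → ℝ)
    (hv : ∑ i, v i ^ 2 = 1) :
    ∃ R, IsReflProduct r (Fintype.card κ - 1) R ∧ ∀ i, R r i = v i := by
  obtain ⟨R, hR, h0, -, hpos⟩ := exists_isReflProduct_eliminate r v (Finset.univ.erase r) (by simp)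
  rw [Finset.card_erase_of_mem (Finset.mem_univ _), Finset.card_univ] at hR
  have hne : (Finset.univ.erase r).Nonempty := by
    rw [← Finset.card_pos, Finset.card_erase_of_mem (Finset.mem_univ _), Finset.card_univ]
    omega
  refine ⟨R, hR, ?_⟩
  set w := R.mulVec v with hw
  have hw0 : ∀ i, i ≠ r → w i = 0 := fun i hi => h0 i (by simp [hi])
  have hback : R.transpose.mulVec w = v := by
    rw [hw, Matrix.mulVec_mulVec, hR.transpose_mul, Matrix.one_mulVec]
  have hvr : ∀ i, v i = R r i * w r := by
    intro i
    rw [← hback, Matrix.mulVec, dotProduct, Finset.sum_eq_single r]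
    · rfl
    · intro l _ hl
      rw [hw0 l hl, mul_zero]
    · simp
  have hrow : ∑ i, R r i ^ 2 = 1 := by
    have := congrFun (congrFun hR.mul_transpose r) r
    rw [Matrix.mul_apply, Matrix.one_apply_eq] at this
    simpa [sq] using this
  have hwr : w r = 1 := by
    have : (∑ i, R r i ^ 2) * w r ^ 2 = 1 := by
      rw [Finset.sum_mul, ← hv]
      exact Finset.sum_congr rfl fun i _ => by rw [hvr i, mul_pow]
    rw [hrow, one_mul] at this
    have := hpos hne
    nlinarith
  intro i
  rw [hvr i, hwr, mul_one]

end Reflections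

section Circuits

variable {E : Type*} [NormedAddCommGroup E] [InnerProductSpace ℂ E] [CompleteSpace E]
variable {n N : ℕ} {h : Fin N → E →L[ℂ] E}
variable {κ : Type*} [Fintype κ] [DecidableEq κ]

/-- The gate on two qubits that acts by `[[c, s], [s, -c]]` on the span of `|10⟩, |01⟩` and fixes
`|00⟩, |11⟩`. -/
def reflGate (c s : ℝ) : Matrix (Bool × Bool) (Bool × Bool) ℂ :=
  Matrix.of fun x y =>
    if x = (true, false) then (if y = (true, false) then c else if y = (false, true) then s else 0)
    else if x = (false, true) then
      (if y = (true, false) then s else if y = (false, true) then -c else 0)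
    else if x = y then 1 else 0

lemma reflGate_mem_unitaryGroup {c s : ℝ} (hcs : c ^ 2 + s ^ 2 = 1) :
    reflGate c s ∈ Matrix.unitaryGroup (Bool × Bool) ℂ := by
  have hcs' : (c : ℂ) ^ 2 + (s : ℂ) ^ 2 = 1 := by exact_mod_cast hcs
  rw [Matrix.mem_unitaryGroup_iff]
  ext ⟨x, x'⟩ ⟨y, y'⟩
  rw [Matrix.mul_apply, Fintype.sum_prod_type]
  simp only [Fintype.sum_bool, Matrix.star_apply]
  cases x <;> cases x' <;> cases y <;> cases y' <;>
    simp [reflGate] <;> first | linear_combination hcs' | ring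

/-- Matrices with scalar entries as matrices with operator entries. -/
def liftMatrix : Matrix κ κ ℝ →+* Matrix κ κ (E →L[ℂ] E) :=
  ((algebraMap ℂ (E →L[ℂ] E)).comp Complex.ofRealHom).mapMatrix

omit [CompleteSpace E] in
lemma liftMatrix_apply (R : Matrix κ κ ℝ) (i j : κ) :
    (liftMatrix R : Matrix κ κ (E →L[ℂ] E)) i j = (R i j : ℂ) • 1 := by
  rw [← Algebra.algebraMap_eq_smul_one]
  rfl

namespace Implementable

variable {ι : κ ↪ Fin n} {P : ℝ → Prop}

lemma reflMatrix {r j : κ} (hj : j ≠ r) {c s : ℝ} (hcs : c ^ 2 + s ^ 2 = 1) :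
    Implementable h ι P 1 0 (liftMatrix (reflMatrix r j c s)) := by
  have hpq : ι r ≠ ι j := fun e => hj (ι.injective e).symm
  refine ⟨[Instr.gate2 (ι r) (ι j) hpq ⟨_, reflGate_mem_unitaryGroup hcs⟩], ?_, by simp,
    by simp [Circuit.gateCount], by simp [Circuit.queryCount], ?_⟩
  · intro g hg
    rw [List.mem_singleton.1 hg]
    exact ⟨⟨r, rfl⟩, ⟨j, rfl⟩⟩
  intro l x
  rw [Circuit.eval_singleton]
  simp only [Instr.eval, Matrix.map_apply, gate2Matrix, Matrix.of_apply]
  have hone : ∀ i l : κ, oneHot ι i (ι l) = decide (l = i) := by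
    intro i l
    simp [oneHot]
  by_cases hx : ∃ i, x = oneHot ι i
  · obtain ⟨i, rfl⟩ := hx
    rw [Finset.sum_eq_single i]
    · rw [if_pos rfl, liftMatrix_apply]
      congr 1
      by_cases hcond : ∀ q, q ≠ ι r → q ≠ ι j → oneHot ι i q = oneHot ι l q
      · rw [if_pos hcond]
        have key : i = l ∨ ((i = r ∨ i = j) ∧ (l = r ∨ l = j)) := by
          by_contra! hcon
          by_cases h1 : i = r ∨ i = j
          · have := hcon.2 h1
            have h2 := hcond (ι l) (by simpa using this.1) (by simpa using this.2)
            rw [hone, hone] at h2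
            simp only [decide_true, decide_eq_true_eq] at h2
            exact hcon.1 h2.symm
          · push Not at h1
            have h2 := hcond (ι i) (by simpa using h1.1) (by simpa using h1.2)
            rw [hone, hone] at h2
            simp only [decide_true] at h2
            exact hcon.1 (by simpa using h2.symm)
        simp only [hone, MultiproductSim.reflMatrix, reflGate, Matrix.of_apply]
        rcases key with rfl | ⟨rfl | rfl, rfl | rfl⟩
        · by_cases h1 : i = r
          · subst h1
            simp [hj]
          · by_cases h2 : i = j
            · subst h2
              simp [hj, Ne.symm hj]
            · simp [h1, h2, Ne.symm h1, Ne.symm h2]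
        · simp [hj]
        · simp [hj, Ne.symm hj]
        · simp [hj, Ne.symm hj]
        · simp [hj, Ne.symm hj]
      · rw [if_neg hcond]
        have h1 : i ≠ l := by
          rintro rfl
          exact hcond fun _ _ _ => rfl
        have h2 : ¬ ((i = r ∨ i = j) ∧ (l = r ∨ l = j)) := by
          rintro ⟨h3, h4⟩
          refine hcond fun q hq1 hq2 => ?_
          have : ∀ b : κ, b = r ∨ b = j → oneHot ι b q = false := by
            rintro b (rfl | rfl) <;> simp [oneHot, hq1, hq2]
          rw [this i h3, this l h4]
        simp only [MultiproductSim.reflMatrix, Matrix.of_apply]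
        by_cases h3 : i = r
        · have h4 : l ≠ r := fun e => h2 ⟨.inl h3, .inl e⟩
          have h5 : l ≠ j := fun e => h2 ⟨.inl h3, .inr e⟩
          simp [h3, h4, h5]
        · by_cases h6 : i = j
          · have h4 : l ≠ r := fun e => h2 ⟨.inr h6, .inl e⟩
            have h5 : l ≠ j := fun e => h2 ⟨.inr h6, .inr e⟩
            simp [h6, hj, h4, h5]
          · simp [h3, h6, h1]
    · intro i' _ hi'
      rw [if_neg fun e => hi' (oneHot_injective ι e).symm]
    · simp
  · rw [Finset.sum_eq_zero fun i _ => if_neg fun e => hx ⟨i, e⟩]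
    split_ifs with hcond
    · convert zero_smul ℂ (1 : E →L[ℂ] E)
      push Not at hx
      have hnot : ∀ i, ¬ ∀ q, x q = oneHot ι i q := fun i e => hx i (funext e)
      simp only [hone, reflGate, Matrix.of_apply]
      by_cases h1 : l = r ∨ l = j
      · -- off the two qubits `x` vanishes, so it is neither `|10⟩` nor `|01⟩` on them
        have hoff : ∀ q, q ≠ ι r → q ≠ ι j → x q = false := by
          intro q hq1 hq2
          rw [hcond q hq1 hq2]
          rcases h1 with rfl | rfl <;> simp [oneHot, hq1, hq2]
        have h10 : ¬ (x (ι r) = true ∧ x (ι j) = false) := by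
          rintro ⟨e1, e2⟩
          refine hnot r fun q => ?_
          by_cases hq1 : q = ι r
          · simp [hq1, oneHot, e1]
          · by_cases hq2 : q = ι j
            · simp [hq2, oneHot, e2, hj]
            · simp [oneHot, hq1, hoff q hq1 hq2]
        have h01 : ¬ (x (ι r) = false ∧ x (ι j) = true) := by
          rintro ⟨e1, e2⟩
          refine hnot j fun q => ?_
          by_cases hq1 : q = ι r
          · simp [hq1, oneHot, e1, Ne.symm hj]
          · by_cases hq2 : q = ι j
            · simp [hq2, oneHot, e2]
            · simp [oneHot, hq2, hoff q hq1 hq2]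
        rcases h1 with rfl | rfl <;>
          cases e1 : x (ι _) <;> cases e2 : x (ι _) <;> simp_all
      · push Not at h1
        have h00 : ¬ (x (ι r) = false ∧ x (ι j) = false) := by
          rintro ⟨e1, e2⟩
          refine hnot l fun q => ?_
          by_cases hq1 : q = ι r
          · simp [hq1, oneHot, e1, Ne.symm h1.1]
          · by_cases hq2 : q = ι j
            · simp [hq2, oneHot, e2, Ne.symm h1.2]
            · exact hcond q hq1 hq2
        cases e1 : x (ι r) <;> cases e2 : x (ι j) <;>
          simp_all [Ne.symm h1.1, Ne.symm h1.2]
    · rw [zero_smul]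

end Implementable

end Circuits

/-! ### One step: linear combination and amplitude amplification -/

section AmplitudeAmplification

variable {κ : Type*} [Fintype κ] [DecidableEq κ]

/-- One round of amplitude amplification, `Z` being the reflection that negates the coordinate `r`.
If `B` and `B'` are the `(r, r)` entries of `V` and of its inverse, then that of `V Z V⁻¹ Z V` is
`4 B B' B - 3 B`. -/
lemma amplification_apply {A : Type*} [Ring A] {V V' : Matrix κ κ A} (h : V * V' = 1)
    (h' : V' * V = 1) (r : κ) :
    (V * (Matrix.diagonal (fun l => if l = r then (-1 : A) else 1) *
      (V' * (Matrix.diagonal (fun l => if l = r then (-1 : A) else 1) * V)))) r r =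
      4 • (V r r * V' r r * V r r) - 3 • V r r := by
  set p₀ : Matrix κ κ A := Matrix.diagonal fun l => if l = r then 1 else 0 with hp₀
  have hZ : Matrix.diagonal (fun l => if l = r then (-1 : A) else 1) = 1 - 2 • p₀ := by
    rw [hp₀, ← Matrix.diagonal_one, ← Matrix.diagonal_smul, Matrix.diagonal_sub]
    congr 1
    ext l
    by_cases hl : l = r <;> simp [hl]
    norm_num
  have e : ∀ X Y : Matrix κ κ A, (X * (p₀ * Y)) r r = X r r * Y r r := by
    intro X Y
    rw [Matrix.mul_apply, Finset.sum_eq_single r]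
    · rw [hp₀, Matrix.diagonal_mul, if_pos rfl, one_mul]
    · intro l _ hl
      rw [hp₀, Matrix.diagonal_mul, if_neg hl, zero_mul, mul_zero]
    · simp
  have h1 : V * ((1 - 2 • p₀) * (V' * ((1 - 2 • p₀) * V))) =
      V - 2 • (V * (p₀ * 1)) - 2 • (1 * (p₀ * V)) + 4 • (V * (p₀ * (V' * (p₀ * V)))) := by
    have h2 : V * ((1 - 2 • p₀) * (V' * ((1 - 2 • p₀) * V))) =
        V * (V' * V) - 2 • (V * (p₀ * (V' * V))) - 2 • (V * (V' * (p₀ * V))) +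
          4 • (V * (p₀ * (V' * (p₀ * V)))) := by noncomm_ring
    rw [h2, h', mul_one, ← mul_assoc V V', h]
  rw [hZ, h1]
  simp only [Matrix.add_apply, Matrix.sub_apply, Matrix.smul_apply, e]
  simp only [Matrix.one_apply_eq, mul_one, one_mul, mul_assoc]
  abel

end AmplitudeAmplification

section Circuits

variable {E : Type*} [NormedAddCommGroup E] [InnerProductSpace ℂ E] [CompleteSpace E]
variable {n N : ℕ} {h : Fin N → E →L[ℂ] E}
variable {κ : Type*} [Fintype κ] [DecidableEq κ]

namespace Implementable

variable {ι : κ ↪ Fin n} {P : ℝ → Prop} {g Q : ℕ} {T : Matrix κ κ (E →L[ℂ] E)}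

lemma of_isReflProduct {r : κ} {R : Matrix κ κ ℝ} (hR : IsReflProduct r g R) :
    Implementable h ι P g 0 (liftMatrix R) := by
  induction hR with
  | one => simpa using one
  | @mul g R j c s hj hcs hR ih =>
    rw [map_mul, add_comm]
    exact (Implementable.reflMatrix hj hcs).mul ih

lemma of_isReflProduct_transpose {r : κ} {R : Matrix κ κ ℝ} (hR : IsReflProduct r g R) :
    Implementable h ι P g 0 (liftMatrix R.transpose) := by
  induction hR with
  | one => simpa using one
  | @mul g R j c s hj hcs hR ih =>
    rw [Matrix.transpose_mul, reflMatrix_transpose, map_mul]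
    exact ih.mul (Implementable.reflMatrix hj hcs)

lemma query_pow (i : κ) {s : ℝ} (hs : P s) (k : ℕ) :
    Implementable h ι P 0 k (Matrix.diagonal fun l => if l = i then U2 h s ^ k else 1) := by
  induction k with
  | zero => simpa using one
  | succ k ih =>
    have := ih.mul (query i hs)
    rw [Matrix.diagonal_mul_diagonal] at this
    have e : ∀ l, (if l = i then U2 h s ^ k else 1) * (if l = i then U2 h s else 1) =
        if l = i then U2 h s ^ (k + 1) else 1 := by
      intro l
      by_cases hl : l = i <;> simp [hl, pow_succ]
    simp only [e] at this
    exact this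

/-- The selection of a product formula by the one-hot state of the register. -/
lemma select {M : ℕ} (f : Fin M ↪ κ) {s : Fin M → ℝ} (hs : ∀ j, P (s j)) (k : Fin M → ℕ)
    {D : κ → E →L[ℂ] E} (hD : ∀ j, D (f j) = U2 h (s j) ^ k j)
    (hD1 : ∀ i, (∀ j, f j ≠ i) → D i = 1) :
    Implementable h ι P 0 (∑ j, k j) (Matrix.diagonal D) := by
  have key : ∀ S : Finset (Fin M), Implementable h ι P 0 (∑ j ∈ S, k j)
      (Matrix.diagonal fun i => if ∃ j ∈ S, f j = i then D i else 1) := by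
    intro S
    induction S using Finset.induction_on with
    | empty => simpa using one
    | @insert j S hj ih =>
      have := (query_pow (h := h) (ι := ι) (f j) (hs j) (k j)).mul ih
      rw [Matrix.diagonal_mul_diagonal] at this
      rw [Finset.sum_insert hj]
      have e : ∀ i, (if i = f j then U2 h (s j) ^ k j else 1) *
          (if ∃ j' ∈ S, f j' = i then D i else 1) =
          if ∃ j' ∈ insert j S, f j' = i then D i else 1 := by
        intro i
        by_cases hi : i = f j
        · have h1 : ¬ ∃ j' ∈ S, f j' = i := by
            rintro ⟨j', hj', e⟩
            rw [hi] at e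
            exact hj (f.injective e ▸ hj')
          rw [if_pos hi, if_neg h1, mul_one, if_pos ⟨j, by simp, hi.symm⟩, hi, hD]
        · rw [if_neg hi, one_mul]
          simp [Ne.symm hi]
      simp only [e] at this
      exact this
  have e : ∀ i, (if ∃ j ∈ Finset.univ, f j = i then D i else 1) = D i := by
    intro i
    split_ifs with hi
    · rfl
    · exact (hD1 i fun j hj => hi ⟨j, by simp, hj⟩).symm
  simpa only [e] using key Finset.univ

/-- Conjugation with a (signed) bit flip on the qubit `ι r` moves the `(r, r)` entry into the
success operator. -/
lemma exists_circuit (hT : Implementable h ι P g Q T) (r : κ) :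
    ∃ C : Circuit n, (∀ x ∈ C, x.SupportedOn (Set.range ι)) ∧
      (∀ q s, Instr.query q s ∈ C → P s) ∧ Circuit.gateCount C ≤ g + 2 ∧
      Circuit.queryCount C ≤ Q ∧ Circuit.successOp h C = -T r r := by
  obtain ⟨C, h1, h2, h3, h4, h5⟩ := hT
  have hunit : ∀ c : ℂ, c * star c = 1 →
      (Matrix.of fun x y : Bool => if x = y then 0 else c) ∈ Matrix.unitaryGroup Bool ℂ := by
    intro c hc
    rw [Matrix.mem_unitaryGroup_iff]
    ext x y
    rw [Matrix.mul_apply]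
    cases x <;> cases y <;> simp [Matrix.star_apply] <;> exact hc
  let X : ∀ c : ℂ, c * star c = 1 → Instr n := fun c hc => Instr.gate1 (ι r) ⟨_, hunit c hc⟩
  have hX0 : ∀ c hc x, (X c hc).eval h x (fun _ => false) =
      if x = oneHot ι r then c • (1 : E →L[ℂ] E) else 0 := by
    intro c hc x
    simp only [X, Instr.eval, Matrix.map_apply, gate1Matrix, Matrix.of_apply]
    by_cases hx : x = oneHot ι r
    · rw [if_pos hx, if_pos]
      · simp [hx, oneHot]
      · intro i hi
        simp [hx, oneHot, hi]
    · rw [if_neg hx]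
      split_ifs with hH hr
      · rw [zero_smul]
      · refine absurd (funext fun q => ?_) hx
        by_cases hq : q = ι r
        · simpa [oneHot, hq] using hr
        · simp [oneHot, hq, hH q hq]
      · rw [zero_smul]
  have h0X : ∀ c hc y, (X c hc).eval h (fun _ => false) y =
      if y = oneHot ι r then c • (1 : E →L[ℂ] E) else 0 := by
    intro c hc y
    rw [← hX0 c hc y]
    simp only [X, Instr.eval, Matrix.map_apply, gate1Matrix, Matrix.of_apply]
    congr 2
    · simp only [eq_comm]
    · simp only [eq_comm]
  have hc1 : (1 : ℂ) * star 1 = 1 := by simp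
  have hc2 : (-1 : ℂ) * star (-1) = 1 := by simp
  refine ⟨[X 1 hc1] ++ (C ++ [X (-1) hc2]), ?_, ?_, ?_, ?_, ?_⟩
  · intro x hx
    simp only [List.mem_append, List.mem_singleton] at hx
    rcases hx with rfl | hx | rfl
    exacts [⟨r, rfl⟩, h1 x hx, ⟨r, rfl⟩]
  · intro q s hx
    simp only [List.mem_append, List.mem_singleton] at hx
    rcases hx with hx | hx | hx
    · cases hx
    · exact h2 q s hx
    · cases hx
  · simp only [Circuit.gateCount_append, X, Circuit.gateCount]
    omega
  · simp only [Circuit.queryCount_append, X, Circuit.queryCount]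
    omega
  · have e1 : ∀ W : Matrix (Fin n → Bool) (Fin n → Bool) (E →L[ℂ] E),
        ((X (-1) hc2).eval h * W * (X 1 hc1).eval h) (fun _ => false) (fun _ => false) =
          -W (oneHot ι r) (oneHot ι r) := by
      intro W
      rw [Matrix.mul_apply]
      simp only [hX0, Matrix.mul_apply, h0X, mul_ite, mul_zero, ite_mul, zero_mul,
        Finset.sum_ite_eq', Finset.mem_univ, if_true]
      simp
    rw [Circuit.successOp, Circuit.eval_append, Circuit.eval_append, Circuit.eval_singleton,
      Circuit.eval_singleton, e1, h5, Finset.sum_eq_single r, if_pos rfl]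
    · intro l _ hl
      rw [if_neg fun e => hl (oneHot_injective ι e).symm]
    · simp

end Implementable

lemma U2_mul_U2_neg [Nontrivial E] (s : ℝ) : U2 h s * U2 h (-s) = 1 := by
  have h1 := ((hasSeries_U2 h).mul ((hasSeries_U2 h).scale (-1))).hasSum s
  have h2 := U2Series_mul_scale h
  have h3 := (HasSeries.one (A := E →L[ℂ] E)).hasSum s
  push_cast at h1
  rw [h2] at h1
  have := h1.unique h3
  simpa using this

lemma U2_pow_mul_U2_neg_pow [Nontrivial E] (s : ℝ) (k : ℕ) :
    U2 h s ^ k * U2 h (-s) ^ k = 1 := by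
  have h1 := U2_mul_U2_neg (h := h) s
  have h2 := U2_mul_U2_neg (h := h) (-s)
  rw [neg_neg] at h2
  rw [← (show Commute (U2 h s) (U2 h (-s)) by rw [Commute, SemiconjBy, h1, h2]).mul_pow, h1,
    one_pow]

/-- A step of the simulation. If `∑ j, |a j| ≤ 2`, the linear combination `X` of product
formulas is prepared with amplitude exactly `1 / 2`, two idle slots absorbing the missing weight, so
one round of amplitude amplification gives `(3 X - X X' X) / 2`, where `X'` is the same
combination at negative times. -/
lemma exists_step_circuit [Nontrivial E] {M : ℕ} (ι : Fin M ⊕ Bool ↪ Fin n) (k : Fin M → ℕ)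
    (a : Fin M → ℝ) (ha : ∑ j, |a j| ≤ 2) {s : ℝ} (hs : 0 ≤ s) :
    ∃ C : Circuit n, (∀ x ∈ C, x.SupportedOn (Set.range ι)) ∧
      (∀ q s', Instr.query q s' ∈ C → ∃ j, |s'| = s / k j) ∧
      Circuit.gateCount C ≤ 6 * M + 10 ∧ Circuit.queryCount C ≤ 3 * ∑ j, k j ∧
      Circuit.successOp h C = (1 / 2 : ℂ) • ((3 : ℂ) • multiproduct h k a s -
        multiproduct h k a s * multiproduct h k a (-s) * multiproduct h k a s) := by
  set ρ : ℝ := √(1 - (∑ j, |a j|) / 2) with hρ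
  have hρsq : ρ ^ 2 = 1 - (∑ j, |a j|) / 2 := Real.sq_sqrt (by linarith)
  let r : Fin M ⊕ Bool := .inr false
  let v : Fin M ⊕ Bool → ℝ := Sum.elim (fun j => √(|a j| / 2)) fun b => if b then 0 else ρ
  let v' : Fin M ⊕ Bool → ℝ :=
    Sum.elim (fun j => SignType.sign (a j) * √(|a j| / 2)) fun b => if b then ρ else 0
  have hsq : ∀ j, √(|a j| / 2) ^ 2 = |a j| / 2 := fun j => Real.sq_sqrt (by positivity)
  have hv : ∑ i, v i ^ 2 = 1 := by
    simp only [v, Fintype.sum_sum_type, Sum.elim_inl, Sum.elim_inr, hsq, Fintype.sum_bool]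
    rw [← Finset.sum_div]
    simp [hρsq]
  have hv' : ∑ i, v' i ^ 2 = 1 := by
    have : ∀ j, ((SignType.sign (a j) : SignType) : ℝ) ^ 2 * (|a j| / 2) = |a j| / 2 := by
      intro j
      rcases lt_trichotomy (a j) 0 with h0 | h0 | h0
      · simp [sign_neg h0]
      · simp [h0]
      · simp [sign_pos h0]
    simp only [v', Fintype.sum_sum_type, Sum.elim_inl, Sum.elim_inr, mul_pow, hsq, this,
      Fintype.sum_bool]
    rw [← Finset.sum_div]
    simp [hρsq]
  have hcard : Fintype.card (Fin M ⊕ Bool) = M + 2 := by simp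
  obtain ⟨R, hR, hRr⟩ := exists_isReflProduct_row r (by omega) v hv
  obtain ⟨R', hR', hRr'⟩ := exists_isReflProduct_row r (by omega) v' hv'
  rw [hcard] at hR hR'
  let D : ℝ → Fin M ⊕ Bool → E →L[ℂ] E := fun t =>
    Sum.elim (fun j => U2 h (t / (k j : ℝ)) ^ k j) fun _ => 1
  let P : ℝ → Prop := fun s' => ∃ j, |s'| = s / k j
  have hP : ∀ t, |t| = s → ∀ j, P (t / (k j : ℝ)) := fun t ht j =>
    ⟨j, by rw [abs_div, ht, Nat.abs_cast]⟩
  have hsel : ∀ t, |t| = s →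
      Implementable h ι P 0 (∑ j, k j) (Matrix.diagonal (D t)) := by
    intro t ht
    refine Implementable.select ⟨Sum.inl, Sum.inl_injective⟩ (s := fun j => t / (k j : ℝ))
      (hP t ht) k (fun j => rfl) ?_
    rintro (j | b) hi
    · exact absurd rfl (hi j)
    · rfl
  have hDD : ∀ t, Matrix.diagonal (D t) * Matrix.diagonal (D (-t)) = 1 := by
    intro t
    rw [Matrix.diagonal_mul_diagonal, ← Matrix.diagonal_one]
    congr 1
    ext1 i
    rcases i with j | b
    · simp only [D, Sum.elim_inl, neg_div]
      exact U2_pow_mul_U2_neg_pow _ _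
    · simp [D]
  have hDD' : Matrix.diagonal (D (-s)) * Matrix.diagonal (D s) = 1 := by
    simpa using hDD (-s)
  have lift_one : ∀ R₁ R₂ : Matrix (Fin M ⊕ Bool) (Fin M ⊕ Bool) ℝ, R₁ * R₂ = 1 →
      (liftMatrix R₁ * liftMatrix R₂ : Matrix _ _ (E →L[ℂ] E)) = 1 := by
    intro R₁ R₂ e
    rw [← map_mul, e, map_one]
  set V : Matrix (Fin M ⊕ Bool) (Fin M ⊕ Bool) (E →L[ℂ] E) :=
    liftMatrix R' * (Matrix.diagonal (D s) * liftMatrix R.transpose) with hV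
  set V' : Matrix (Fin M ⊕ Bool) (Fin M ⊕ Bool) (E →L[ℂ] E) :=
    liftMatrix R * (Matrix.diagonal (D (-s)) * liftMatrix R'.transpose) with hV'
  have hVimp : Implementable h ι P (2 * M + 2) (∑ j, k j) V :=
    ((Implementable.of_isReflProduct hR').mul ((hsel s (abs_of_nonneg hs)).mul
      (Implementable.of_isReflProduct_transpose hR))).mono (by omega) (by omega)
  have hVimp' : Implementable h ι P (2 * M + 2) (∑ j, k j) V' :=
    ((Implementable.of_isReflProduct hR).mul ((hsel (-s) (by rw [abs_neg, abs_of_nonneg hs])).mul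
      (Implementable.of_isReflProduct_transpose hR'))).mono (by omega) (by omega)
  have cancel : ∀ {X₁ X₂ X₃ Y₁ Y₂ Y₃ : Matrix (Fin M ⊕ Bool) (Fin M ⊕ Bool) (E →L[ℂ] E)},
      X₁ * Y₁ = 1 → X₂ * Y₂ = 1 → X₃ * Y₃ = 1 → X₁ * (X₂ * X₃) * (Y₃ * (Y₂ * Y₁)) = 1 := by
    intro X₁ X₂ X₃ Y₁ Y₂ Y₃ e₁ e₂ e₃
    calc X₁ * (X₂ * X₃) * (Y₃ * (Y₂ * Y₁)) = X₁ * (X₂ * ((X₃ * Y₃) * Y₂)) * Y₁ := by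
          simp only [mul_assoc]
      _ = 1 := by rw [e₃, one_mul, e₂, mul_one, e₁]
  have hVV' : V * V' = 1 := cancel (lift_one _ _ hR'.mul_transpose) (hDD s)
    (lift_one _ _ hR.transpose_mul)
  have hV'V : V' * V = 1 := cancel (lift_one _ _ hR.mul_transpose) hDD'
    (lift_one _ _ hR'.transpose_mul)
  have hentry : ∀ (R₁ R₂ : Matrix (Fin M ⊕ Bool) (Fin M ⊕ Bool) ℝ) (t : ℝ),
      (∀ i, R₁ r i * R₂ r i = v i * v' i) →
      (liftMatrix R₁ * (Matrix.diagonal (D t) * liftMatrix R₂.transpose) :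
        Matrix _ _ (E →L[ℂ] E)) r r = (1 / 2 : ℂ) • multiproduct h k a t := by
    intro R₁ R₂ t hi
    rw [Matrix.mul_apply]
    have hterm : ∀ i, (liftMatrix R₁ r i : E →L[ℂ] E) *
        (Matrix.diagonal (D t) * liftMatrix R₂.transpose : Matrix _ _ (E →L[ℂ] E)) i r =
        ((v i * v' i : ℝ) : ℂ) • D t i := by
      intro i
      rw [Matrix.diagonal_mul, liftMatrix_apply, liftMatrix_apply, Matrix.transpose_apply,
        mul_smul_comm, mul_one, smul_mul_smul_comm, one_mul, ← hi]
      push_cast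
      rfl
    have hcoef : ∀ j, v (.inl j) * v' (.inl j) = a j / 2 := by
      intro j
      calc v (.inl j) * v' (.inl j) = SignType.sign (a j) * √(|a j| / 2) ^ 2 := by
            simp only [v, v', Sum.elim_inl]
            ring
        _ = SignType.sign (a j) * |a j| / 2 := by rw [hsq]; ring
        _ = a j / 2 := by rw [sign_mul_abs]
    simp only [hterm]
    rw [Fintype.sum_sum_type, Fintype.sum_bool]
    simp only [hcoef]
    rw [multiproduct, Finset.smul_sum]
    have hpad : ∀ b, v (.inr b) * v' (.inr b) = 0 := by
      intro b
      cases b <;> simp [v, v']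
    rw [hpad, hpad]
    simp only [Complex.ofReal_zero, zero_smul, add_zero]
    refine Finset.sum_congr rfl fun j _ => ?_
    rw [smul_smul]
    congr 1
    push_cast
    ring
  have hVr : V r r = (1 / 2 : ℂ) • multiproduct h k a s :=
    hentry _ _ _ fun i => by rw [hRr, hRr', mul_comm]
  have hVr' : V' r r = (1 / 2 : ℂ) • multiproduct h k a (-s) :=
    hentry _ _ _ fun i => by rw [hRr, hRr']
  have hZ := Implementable.pauliZ (h := h) (ι := ι) (P := P) r
  obtain ⟨C, h1, h2, h3, h4, h5⟩ :=
    (hVimp.mul (hZ.mul (hVimp'.mul (hZ.mul hVimp)))).exists_circuit r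
  refine ⟨C, h1, h2, by omega, by omega, ?_⟩
  rw [h5, amplification_apply hVV' hV'V, hVr, hVr']
  simp only [smul_mul_assoc, mul_smul_comm, smul_smul, ← Nat.cast_smul_eq_nsmul ℂ, smul_sub]
  rw [neg_sub]
  congr 2 <;> norm_num

end Circuits

/-! ### Error propagation and choice of parameters -/

section Evolution

variable {E : Type*} [NormedAddCommGroup E] [InnerProductSpace ℂ E] [CompleteSpace E]

lemma evolution_add (A : E →L[ℂ] E) (s t : ℝ) :
    evolution A (s + t) = evolution A s * evolution A t := by
  let _ : NormedAlgebra ℚ (E →L[ℂ] E) := .restrictScalars ℚ ℂ _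
  rw [evolution, evolution, evolution, ← NormedSpace.exp_add_of_commute]
  · rw [← add_smul]
    push_cast
    rw [mul_add]
  · exact ((Commute.refl A).smul_left _).smul_right _

lemma evolution_zero (A : E →L[ℂ] E) : evolution A 0 = 1 := by
  simp [evolution, NormedSpace.exp_zero]

lemma evolution_mul_evolution_neg (A : E →L[ℂ] E) (s : ℝ) :
    evolution A s * evolution A (-s) = 1 := by
  rw [← evolution_add, add_neg_cancel, evolution_zero]

lemma evolution_pow (A : E →L[ℂ] E) (s : ℝ) (n : ℕ) : evolution A s ^ n = evolution A (n * s) := by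
  induction n with
  | zero => simp [evolution_zero]
  | succ n ih =>
    rw [pow_succ, ih, ← evolution_add]
    congr 1
    push_cast
    ring

lemma norm_evolution_apply {A : E →L[ℂ] E} (hA : IsSelfAdjoint A) (s : ℝ) (ψ : E) :
    ‖evolution A s ψ‖ = ‖ψ‖ := by
  let _ : NormedAlgebra ℚ (E →L[ℂ] E) := .restrictScalars ℚ ℂ _
  have hskew : (-Complex.I * (s : ℂ)) • A ∈ skewAdjoint (E →L[ℂ] E) := by
    rw [skewAdjoint.mem_iff, star_smul, hA.star_eq, ← neg_smul]
    congr 1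
    simp
  have hu := NormedSpace.exp_mem_unitary_of_mem_skewAdjoint hskew
  exact ContinuousLinearMap.norm_map_of_mem_unitary hu ψ

lemma norm_evolution_le {A : E →L[ℂ] E} (hA : IsSelfAdjoint A) (s : ℝ) : ‖evolution A s‖ ≤ 1 :=
  ContinuousLinearMap.opNorm_le_bound _ zero_le_one fun ψ => by
    rw [norm_evolution_apply hA, one_mul]

lemma isSelfAdjoint_hamiltonian {N : ℕ} {h : Fin N → E →L[ℂ] E} (hh : ∀ j, IsSelfAdjoint (h j)) :
    IsSelfAdjoint (hamiltonian h) := by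
  rw [IsSelfAdjoint, hamiltonian, star_sum]
  exact Finset.sum_congr rfl fun j _ => (hh j).star_eq

omit [CompleteSpace E] in
/-- The success probability of an operator close to an isometry, and the error of its normalized
output. -/
lemma normalized_output_bounds {A W : E →L[ℂ] E} {δ : ℝ} (hδ : δ < 1) (h : ‖A - W‖ ≤ δ) {ψ : E}
    (hψ : ‖ψ‖ = 1) (hW : ‖W ψ‖ = 1) :
    0 < ‖A ψ‖ ^ 2 ∧ 1 - 2 * δ ≤ ‖A ψ‖ ^ 2 ∧
      ‖((‖A ψ‖⁻¹ : ℝ) : ℂ) • A ψ - W ψ‖ ≤ 2 * δ := by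
  have h1 : ‖A ψ - W ψ‖ ≤ δ := by
    rw [← sub_apply]
    refine (ContinuousLinearMap.le_opNorm _ _).trans ?_
    rwa [hψ, mul_one]
  have h2 : |‖A ψ‖ - 1| ≤ δ := by
    rw [← hW]
    exact (abs_norm_sub_norm_le _ _).trans h1
  have h3 := abs_le.1 h2
  have hpos : 0 < ‖A ψ‖ := by linarith
  refine ⟨by positivity, by nlinarith, ?_⟩
  have h4 : ‖((‖A ψ‖⁻¹ : ℝ) : ℂ) • A ψ - A ψ‖ ≤ δ := by
    have : ((‖A ψ‖⁻¹ : ℝ) : ℂ) • A ψ - A ψ = (((‖A ψ‖⁻¹ - 1 : ℝ)) : ℂ) • A ψ := by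
      push_cast
      rw [sub_smul, one_smul]
    rw [this, norm_smul, Complex.norm_real, Real.norm_eq_abs]
    calc |‖A ψ‖⁻¹ - 1| * ‖A ψ‖ = |(‖A ψ‖⁻¹ - 1) * ‖A ψ‖| := by rw [abs_mul, abs_of_pos hpos]
      _ = |‖A ψ‖ - 1| := by
        rw [sub_mul, inv_mul_cancel₀ hpos.ne', one_mul, abs_sub_comm]
      _ ≤ δ := h2
  calc _ = ‖(((‖A ψ‖⁻¹ : ℝ) : ℂ) • A ψ - A ψ) + (A ψ - W ψ)‖ := by rw [sub_add_sub_cancel]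
    _ ≤ δ + δ := (norm_add_le _ _).trans (add_le_add h4 h1)
    _ = 2 * δ := by ring

end Evolution

section ErrorPropagation

variable {A : Type*} [NormedRing A] [NormOneClass A]

lemma norm_pow_sub_pow_le {Y W : A} {η : ℝ} {r : ℕ} (hη : 0 ≤ η) (hW : ‖W‖ ≤ 1)
    (h : ‖Y - W‖ ≤ η) (hr : r * η ≤ 1) : ‖Y ^ r - W ^ r‖ ≤ 2 * (r * η) := by
  have hY : ‖Y‖ ≤ 1 + η := by
    calc ‖Y‖ = ‖W + (Y - W)‖ := by rw [add_sub_cancel]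
      _ ≤ 1 + η := (norm_add_le _ _).trans (add_le_add hW h)
  have key : ∀ i : ℕ, ‖Y ^ i - W ^ i‖ ≤ (1 + η) ^ i - 1 := by
    intro i
    induction i with
    | zero => simp
    | succ i ih =>
      have e : Y ^ (i + 1) - W ^ (i + 1) = Y ^ i * (Y - W) + (Y ^ i - W ^ i) * W := by
        rw [pow_succ, pow_succ]
        noncomm_ring
      have hYi : ‖Y ^ i‖ ≤ (1 + η) ^ i := (norm_pow_le _ _).trans (by gcongr)
      have h0 : 0 ≤ (1 + η) ^ i - 1 := (norm_nonneg _).trans ih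
      rw [e]
      calc _ ≤ ‖Y ^ i‖ * ‖Y - W‖ + ‖Y ^ i - W ^ i‖ * ‖W‖ :=
            (norm_add_le _ _).trans (add_le_add (norm_mul_le _ _) (norm_mul_le _ _))
        _ ≤ (1 + η) ^ i * η + ((1 + η) ^ i - 1) * 1 := by gcongr
        _ = (1 + η) ^ (i + 1) - 1 := by ring
  have hexp : (1 + η) ^ r ≤ Real.exp (r * η) := by
    rw [Real.exp_nat_mul]
    gcongr
    linarith [Real.add_one_le_exp η]
  have hr0 : 0 ≤ r * η := by positivity
  have h2 := Real.abs_exp_sub_one_le (x := r * η) (by rwa [abs_of_nonneg hr0])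
  rw [abs_of_nonneg hr0] at h2
  linarith [key r, le_abs_self (Real.exp (r * η) - 1)]

omit [NormOneClass A] in
/-- If `X` and `X'` are close to contractions `W` and `W'` inverse to each other, then so is
`(3 X - X X' X) / 2` to `W`. -/
lemma norm_amplified_sub_le [NormedAlgebra ℂ A] {X X' W W' : A} {δ : ℝ} (hδ : δ ≤ 1)
    (hWW : W * W' = 1) (hW : ‖W‖ ≤ 1) (hX : ‖X - W‖ ≤ δ) (hX' : ‖X' - W'‖ ≤ δ)
    (hW' : ‖W'‖ ≤ 1) :
    ‖(1 / 2 : ℂ) • ((3 : ℂ) • X - X * X' * X) - W‖ ≤ 5 * δ := by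
  have hδ0 : 0 ≤ δ := (norm_nonneg _).trans hX
  have hX2 : ‖X‖ ≤ 2 := by
    calc ‖X‖ = ‖W + (X - W)‖ := by rw [add_sub_cancel]
      _ ≤ 1 + δ := (norm_add_le _ _).trans (add_le_add hW hX)
      _ ≤ 2 := by linarith
  have hX2' : ‖X'‖ ≤ 2 := by
    calc ‖X'‖ = ‖W' + (X' - W')‖ := by rw [add_sub_cancel]
      _ ≤ 1 + δ := (norm_add_le _ _).trans (add_le_add hW' hX')
      _ ≤ 2 := by linarith
  have e1 : X * X' * X - W = (X - W) * (X' * X) + W * ((X' - W') * X) + (X - W) := by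
    have : W * ((X' - W') * X) = W * (X' * X) - (W * W') * X := by noncomm_ring
    rw [this, hWW, one_mul, sub_mul, mul_assoc]
    abel
  have h1 : ‖X * X' * X - W‖ ≤ 7 * δ := by
    rw [e1]
    calc _ ≤ ‖X - W‖ * (‖X'‖ * ‖X‖) + ‖W‖ * (‖X' - W'‖ * ‖X‖) + ‖X - W‖ := by
          refine (norm_add_le _ _).trans (add_le_add ((norm_add_le _ _).trans (add_le_add ?_ ?_))
            le_rfl)
          · refine (norm_mul_le _ _).trans ?_
            gcongr
            exact norm_mul_le _ _
          · refine (norm_mul_le _ _).trans ?_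
            gcongr
            exact norm_mul_le _ _
      _ ≤ δ * (2 * 2) + 1 * (δ * 2) + δ := by gcongr
      _ = 7 * δ := by ring
  have e2 : (1 / 2 : ℂ) • ((3 : ℂ) • X - X * X' * X) - W =
      (3 / 2 : ℂ) • (X - W) - (1 / 2 : ℂ) • (X * X' * X - W) := by
    module
  rw [e2]
  calc _ ≤ ‖(3 / 2 : ℂ)‖ * ‖X - W‖ + ‖(1 / 2 : ℂ)‖ * ‖X * X' * X - W‖ := by
        rw [← norm_smul, ← norm_smul]
        exact norm_sub_le _ _
    _ ≤ 3 / 2 * δ + 1 / 2 * (7 * δ) := by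
        gcongr <;> norm_num
    _ = 5 * δ := by ring

end ErrorPropagation

/-- An order `m` with `m * log m` comparable to `y`. -/
lemma exists_order {y : ℝ} (hy : 0 ≤ y) :
    ∃ m : ℕ, 2 ≤ m ∧ y ≤ m * Real.log m ∧ m * Real.log m ≤ 2 * Real.log 2 + 3 * y := by
  classical
  have hex : ∃ m : ℕ, 2 ≤ m ∧ y ≤ m * Real.log m := by
    refine ⟨⌈y⌉₊ + 3, by omega, ?_⟩
    have h1 : y ≤ ((⌈y⌉₊ + 3 : ℕ) : ℝ) := by
      push_cast
      linarith [Nat.le_ceil y]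
    have h2 : 1 ≤ Real.log ((⌈y⌉₊ + 3 : ℕ) : ℝ) := by
      rw [Real.le_log_iff_exp_le (by positivity)]
      have : (0 : ℝ) ≤ (⌈y⌉₊ : ℝ) := by positivity
      push_cast
      linarith [Real.exp_one_lt_three]
    nlinarith
  obtain ⟨h2, hym⟩ := Nat.find_spec hex
  set m := Nat.find hex with hm
  refine ⟨m, h2, hym, ?_⟩
  have hlog2 : 0 < Real.log 2 := Real.log_pos (by norm_num)
  rcases h2.eq_or_lt with h | h
  · rw [← h]
    push_cast
    linarith
  · have hmin := Nat.find_min hex (m := m - 1) (by omega)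
    push Not at hmin
    have h3 := hmin (by omega)
    obtain ⟨d, hd⟩ : ∃ d, m = d + 1 := ⟨m - 1, by omega⟩
    rw [hd, Nat.add_sub_cancel] at h3
    have hd2 : (2 : ℝ) ≤ d := by exact_mod_cast (show 2 ≤ d by omega)
    have hlogd : 0 ≤ Real.log d := Real.log_nonneg (by linarith)
    have h4 : Real.log ((d : ℝ) + 1) ≤ 2 * Real.log d := by
      rw [← Nat.cast_two, ← Real.log_pow]
      exact Real.log_le_log (by positivity) (by nlinarith)
    rw [hd]
    push_cast
    calc ((d : ℝ) + 1) * Real.log ((d : ℝ) + 1) ≤ (3 / 2 * d) * (2 * Real.log d) := by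
          gcongr
          · exact Real.log_nonneg (by linarith)
          · linarith
      _ = 3 * (d * Real.log d) := by ring
      _ ≤ 2 * Real.log 2 + 3 * y := by linarith

lemma exp_le_factorial {m : ℕ} (hm : 0 < m) :
    Real.exp (m * Real.log m) ≤ ((2 * m + 1).factorial : ℝ) := by
  have hm' : (0 : ℝ) < m := by exact_mod_cast hm
  rw [Real.exp_nat_mul, Real.exp_log hm']
  have h1 : m ^ m ≤ (2 * m + 1).factorial :=
    calc m ^ m ≤ (m + 1) ^ m := Nat.pow_le_pow_left (by omega) _
      _ ≤ m.factorial * (m + 1) ^ m := Nat.le_mul_of_pos_left _ (Nat.factorial_pos _)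
      _ ≤ (m + m).factorial := Nat.factorial_mul_pow_le_factorial
      _ ≤ (2 * m + 1).factorial := Nat.factorial_le (by omega)
  exact_mod_cast h1

section Circuits

variable {E : Type*} [NormedAddCommGroup E] [InnerProductSpace ℂ E] [CompleteSpace E]

/-- Successive steps on fresh registers multiply their success operators. -/
lemma exists_circuit_pow [Nontrivial E] {N M : ℕ} (h : Fin N → E →L[ℂ] E) (k : Fin M → ℕ)
    (a : Fin M → ℝ) (ha : ∑ j, |a j| ≤ 2) {s : ℝ} (hs : 0 ≤ s) (r : ℕ) :
    ∃ (n : ℕ) (C : Circuit n), (∀ q s', Instr.query q s' ∈ C → ∃ j, |s'| = s / k j) ∧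
      Circuit.gateCount C ≤ r * (6 * M + 10) ∧ Circuit.queryCount C ≤ r * (3 * ∑ j, k j) ∧
      Circuit.successOp h C = ((1 / 2 : ℂ) • ((3 : ℂ) • multiproduct h k a s -
        multiproduct h k a s * multiproduct h k a (-s) * multiproduct h k a s)) ^ r := by
  set S := (1 / 2 : ℂ) • ((3 : ℂ) • multiproduct h k a s -
    multiproduct h k a s * multiproduct h k a (-s) * multiproduct h k a s)
  let e := Fintype.equivFin (Fin r × (Fin M ⊕ Bool))
  let ι : Fin r → (Fin M ⊕ Bool) ↪ Fin (Fintype.card (Fin r × (Fin M ⊕ Bool))) := fun i =>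
    ⟨fun l => e (i, l), fun l l' hl => by simpa using hl⟩
  have hι : ∀ i l, e.symm (ι i l) = (i, l) := fun i l => e.symm_apply_apply (i, l)
  have key : ∀ i ≤ r, ∃ C : Circuit (Fintype.card (Fin r × (Fin M ⊕ Bool))),
      (∀ x ∈ C, x.SupportedOn {q | ((e.symm q).1 : ℕ) < i}) ∧
      (∀ q s', Instr.query q s' ∈ C → ∃ j, |s'| = s / k j) ∧
      Circuit.gateCount C ≤ i * (6 * M + 10) ∧ Circuit.queryCount C ≤ i * (3 * ∑ j, k j) ∧
      Circuit.successOp h C = S ^ i := by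
    intro i
    induction i with
    | zero =>
      refine fun _ => ⟨[], by simp, by simp, by simp [Circuit.gateCount],
        by simp [Circuit.queryCount], ?_⟩
      simp [Circuit.successOp, Circuit.eval]
    | succ i ih =>
      intro hi
      obtain ⟨C, h1, h2, h3, h4, h5⟩ := ih (by omega)
      obtain ⟨C', h1', h2', h3', h4', h5'⟩ := exists_step_circuit (h := h) (ι ⟨i, hi⟩) k a ha hs
      refine ⟨C ++ C', ?_, ?_, ?_, ?_, ?_⟩
      · intro x hx
        rcases List.mem_append.1 hx with hx | hx
        · exact (h1 x hx).mono fun q (hq : _ < _) => hq.trans (Nat.lt_succ_self i)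
        · refine (h1' x hx).mono ?_
          rintro _ ⟨l, rfl⟩
          simp only [Set.mem_ofPred_eq, hι]
          exact Nat.lt_succ_self i
      · intro q s' hx
        rcases List.mem_append.1 hx with hx | hx
        exacts [h2 q s' hx, h2' q s' hx]
      · rw [Circuit.gateCount_append, add_mul, one_mul]
        omega
      · rw [Circuit.queryCount_append, add_mul, one_mul]
        omega
      · rw [Circuit.successOp_append h ?_ h1 h1', h5, h5', pow_succ']
        rw [Set.disjoint_left]
        rintro _ hq ⟨l, rfl⟩
        simp only [Set.mem_ofPred_eq, hι] at hq
        exact lt_irrefl _ hq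
  obtain ⟨C, -, h2, h3, h4, h5⟩ := key r le_rfl
  exact ⟨_, C, h2, h3, h4, h5⟩

/-- Simulation with given multiproduct coefficients and `r` steps, when the error bound of a single
step is small compared with `ε / r`. -/
lemma exists_simulation_circuit [Nontrivial E] {N m M r : ℕ} {h : Fin N → E →L[ℂ] E}
    (hh : ∀ j, IsSelfAdjoint (h j)) {k : Fin M → ℕ} {a : Fin M → ℝ} (hm : 0 < m)
    (hka : IsMultiproduct m k a) (ha : ∑ j, |a j| ≤ 2) {t ε : ℝ} (ht : 0 < t) (hε1 : ε ≤ 1)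
    (hr0 : 0 < r) (htr1 : t * lam h ≤ r)
    (hrδ : r * (9 / ((2 * m + 1).factorial : ℝ)) ≤ ε / 40) :
    ∃ (n : ℕ) (C : Circuit n), (∀ q s, Instr.query q s ∈ C → ∃ j, |s| = t / r / k j) ∧
      Circuit.gateCount C ≤ r * (6 * M + 10) ∧ Circuit.queryCount C ≤ r * (3 * ∑ j, k j) ∧
      ‖multiproduct h k a (t / r) ^ r - evolution (hamiltonian h) t‖ ≤ ε / 4 ∧
      ‖C.successOp h - evolution (hamiltonian h) t‖ ≤ ε / 4 := by
  have hr0' : (0 : ℝ) < r := by exact_mod_cast hr0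
  have hr1' : (1 : ℝ) ≤ r := by exact_mod_cast hr0
  set δ : ℝ := 9 / ((2 * m + 1).factorial : ℝ) with hδ
  have hδ0 : 0 ≤ δ := by positivity
  have hδ1 : δ ≤ 1 := by nlinarith
  have hstep : ∀ s : ℝ, |s| = t / r →
      ‖multiproduct h k a s - evolution (hamiltonian h) s‖ ≤ δ := by
    intro s hs
    have h1 : |s| * lam h ≤ 1 := by
      rw [hs, div_mul_eq_mul_div, div_le_one hr0']
      exact htr1
    refine (norm_multiproduct_sub_evolution_le h hm hka h1).trans ?_
    calc (∑ j, |a j| + 1) * (3 / ((2 * m + 1).factorial : ℝ))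
        ≤ (2 + 1) * (3 / ((2 * m + 1).factorial : ℝ)) := by gcongr
      _ = δ := by rw [hδ]; ring
  have htr : 0 ≤ t / r := by positivity
  have hsa := isSelfAdjoint_hamiltonian hh
  have hX := hstep (t / r) (abs_of_nonneg htr)
  have hX' := hstep (-(t / r)) (by rw [abs_neg, abs_of_nonneg htr])
  have hY := norm_amplified_sub_le hδ1 (evolution_mul_evolution_neg _ _)
    (norm_evolution_le hsa _) hX hX' (norm_evolution_le hsa _)
  have hWr : evolution (hamiltonian h) (t / r) ^ r = evolution (hamiltonian h) t := by
    rw [evolution_pow, mul_div_cancel₀ _ hr0'.ne']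
  have hXr := norm_pow_sub_pow_le hδ0 (norm_evolution_le hsa _) hX (r := r) (by linarith)
  have hYr := norm_pow_sub_pow_le (by positivity) (norm_evolution_le hsa _) hY (r := r) (by linarith)
  obtain ⟨n, C, hC1, hC2, hC3, hC4⟩ := exists_circuit_pow h k a ha htr r
  rw [← hC4] at hYr
  rw [hWr] at hXr hYr
  have hrδ0 : 0 ≤ r * δ := by positivity
  exact ⟨n, C, hC1, hC2, hC3, by linarith, by linarith⟩

end Circuits

end MultiproductSim

end

open MultiproductSim in
theorem theorem2 (τ σ : ℝ) (hτ : 0 < τ) (hσ : 1 < σ) :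
    ∃ c K : ℝ, 0 < c ∧ 0 < K ∧
      ∀ (E : Type*) [NormedAddCommGroup E] [InnerProductSpace ℂ E] [CompleteSpace E]
        (N : ℕ) (h : Fin N → E →L[ℂ] E) (_ : ∀ j, IsSelfAdjoint (h j))
        (t ε : ℝ) (_ : 0 < ε) (_ : ε ≤ 1)
        (_ : τ ≤ t * lam h) (_ : σ ≤ t * lam h / ε),
      ∃ (m M : ℕ) (k : Fin M → ℕ) (a : Fin M → ℝ) (r n : ℕ) (C : Circuit n),
        -- a well-conditioned multiproduct formula of order `2 m`
        2 ≤ m ∧ IsMultiproduct m k a ∧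
        ∑ j, (k j : ℝ) ≤ K * ((m : ℝ) ^ 2 * Real.log m) ∧
        ∑ j, |a j| ≤ K * Real.log m ∧
        -- the number of steps
        0 < r ∧ c * (t * lam h) ≤ r ∧ (r : ℝ) ≤ K * (t * lam h) ∧
        -- the approximation error
        ‖multiproduct h k a (t / r) ^ r - evolution (hamiltonian h) t‖ ≤ ε ∧
        -- the circuit implements the multiproduct formula, from the product formulas in it
        (∀ q s, Instr.query q s ∈ C → ∃ j, |s| = t / r / k j) ∧
        ‖C.successOp h - multiproduct h k a (t / r) ^ r‖ ≤ ε ∧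
        ‖C.successOp h - evolution (hamiltonian h) t‖ ≤ ε ∧
        -- success probability, and error of the output state
        (∀ ψ : E, ‖ψ‖ = 1 →
          0 < C.successProb h ψ ∧ 1 - K * ε ≤ C.successProb h ψ ∧
          ‖C.output h ψ - evolution (hamiltonian h) t ψ‖ ≤ ε) ∧
        -- query and gate cost
        (C.queryCount : ℝ) ≤ K * (t * lam h * Real.log (t * lam h / ε) ^ 2) ∧
        (C.gateCount : ℝ) ≤ K * (t * lam h * Real.log (t * lam h / ε)) := by
  obtain ⟨K₁, hK₁, hcoef⟩ := exists_wellConditioned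
  have hlog2 : 0 < Real.log 2 := Real.log_pos (by norm_num)
  have hlogσ : 0 < Real.log σ := Real.log_pos hσ
  -- `r ≤ ρ * (t * lam h)`, and `m * log m ≤ K₂ * log (t * lam h / ε)`
  set ρ : ℝ := 1 + 1 / τ with hρ
  have hρ1 : 1 ≤ ρ := by
    have : 0 < 1 / τ := by positivity
    linarith
  have hC₀ : 0 ≤ Real.log (360 * ρ) := Real.log_nonneg (by linarith)
  set K₂ : ℝ := (2 * Real.log 2 + 3 * Real.log (360 * ρ)) / Real.log σ + 3 with hK₂
  have hK₂0 : 0 < K₂ := by positivity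
  set Kq : ℝ := 3 * ρ * K₁ * K₂ ^ 2 / Real.log 2 with hKq
  set Kg : ℝ := ρ * (6 * K₁ + 10) * K₂ / Real.log 2 with hKg
  have hKq0 : 0 ≤ Kq := by positivity
  have hKg0 : 0 ≤ Kg := by positivity
  have hKa : 0 ≤ 2 / Real.log 2 := by positivity
  refine ⟨1, K₁ + 2 / Real.log 2 + ρ + Kq + Kg, one_pos, by positivity, ?_⟩
  intro E _ _ _ N h hh t ε hε hε1 hτt hσt
  set T : ℝ := t * lam h with hT
  set K : ℝ := K₁ + 2 / Real.log 2 + ρ + Kq + Kg with hK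
  have hT0 : 0 < T := hτ.trans_le hτt
  have hlam : 0 < lam h := by
    refine (lam_nonneg h).lt_of_ne fun e => ?_
    rw [hT, ← e, mul_zero] at hT0
    exact lt_irrefl _ hT0
  have ht : 0 < t := pos_of_mul_pos_left hT0 hlam.le
  have : Nontrivial E := by
    by_contra hE
    rw [not_nontrivial_iff_subsingleton] at hE
    have : lam h = 0 := Finset.sum_eq_zero fun j _ => by
      rw [Subsingleton.elim (h j) 0, norm_zero]
    exact hlam.ne' this
  set L : ℝ := Real.log (T / ε) with hL
  have hLσ : Real.log σ ≤ L := Real.log_le_log (by linarith) hσt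
  have hL0 : 0 < L := hlogσ.trans_le hLσ
  -- the number of steps
  set r : ℕ := ⌈T⌉₊ with hr
  have hr0 : 0 < r := Nat.ceil_pos.2 hT0
  have hr0' : (0 : ℝ) < r := by exact_mod_cast hr0
  have hr1' : (1 : ℝ) ≤ r := by exact_mod_cast hr0
  have hTr : T ≤ r := Nat.le_ceil T
  have hrT : (r : ℝ) ≤ ρ * T := by
    have h1 : (r : ℝ) < T + 1 := Nat.ceil_lt_add_one hT0.le
    have h2 : 1 ≤ 1 / τ * T := by
      rw [one_div_mul_eq_div, le_div_iff₀ hτ, one_mul]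
      exact hτt
    rw [hρ, add_mul, one_mul]
    linarith
  -- the order
  obtain ⟨m, hm, hym, hmy⟩ := exists_order (y := Real.log (360 * ρ) + L) (by positivity)
  obtain ⟨M, k, a, hka, hk, ha, hM⟩ := hcoef m hm
  have hm' : (2 : ℝ) ≤ m := by exact_mod_cast hm
  have hlogm : Real.log 2 ≤ Real.log m := Real.log_le_log (by norm_num) hm'
  have hmL : m * Real.log m ≤ K₂ * L := by
    have h1 : 2 * Real.log 2 + 3 * Real.log (360 * ρ) ≤
        (2 * Real.log 2 + 3 * Real.log (360 * ρ)) / Real.log σ * L := by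
      rw [div_mul_eq_mul_div, le_div_iff₀ hlogσ]
      gcongr
    calc m * Real.log m ≤ 2 * Real.log 2 + 3 * (Real.log (360 * ρ) + L) := hmy
      _ = (2 * Real.log 2 + 3 * Real.log (360 * ρ)) + 3 * L := by ring
      _ ≤ K₂ * L := by rw [hK₂, add_mul]; linarith
  have hmL' : (m : ℝ) ≤ K₂ * L / Real.log 2 := by
    rw [le_div_iff₀ hlog2]
    refine le_trans ?_ hmL
    gcongr
  have hm2L : (m : ℝ) ^ 2 * Real.log m ≤ (K₂ * L) ^ 2 / Real.log 2 := by
    rw [le_div_iff₀ hlog2]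
    have h0 : 0 ≤ Real.log m := hlog2.le.trans hlogm
    calc (m : ℝ) ^ 2 * Real.log m * Real.log 2 ≤ (m : ℝ) ^ 2 * Real.log m * Real.log m := by gcongr
      _ = (m * Real.log m) ^ 2 := by ring
      _ ≤ (K₂ * L) ^ 2 := by gcongr
  -- the error of one step
  have hfac : 360 * ρ * (T / ε) ≤ ((2 * m + 1).factorial : ℝ) := by
    have h1 : 0 < T / ε := by positivity
    calc 360 * ρ * (T / ε) = Real.exp (Real.log (360 * ρ) + L) := by
          rw [Real.exp_add, Real.exp_log (by positivity), hL, Real.exp_log h1]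
      _ ≤ Real.exp (m * Real.log m) := Real.exp_le_exp.2 hym
      _ ≤ _ := exp_le_factorial (by omega)
  have hfac0 : (0 : ℝ) < ((2 * m + 1).factorial : ℝ) := by
    exact_mod_cast Nat.factorial_pos _
  have hrδ : r * (9 / ((2 * m + 1).factorial : ℝ)) ≤ ε / 40 := by
    rw [← mul_div_assoc, div_le_div_iff₀ hfac0 (by norm_num)]
    have h1 : 360 * ρ * T ≤ ε * ((2 * m + 1).factorial : ℝ) := by
      calc 360 * ρ * T = ε * (360 * ρ * (T / ε)) := by field_simp
        _ ≤ _ := by gcongr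
    linarith
  obtain ⟨n, C, hC1, hC2, hC3, hXW, hAW⟩ :=
    exists_simulation_circuit hh (by omega) hka ha ht hε1 hr0 hTr hrδ
  refine ⟨m, M, k, a, r, n, C, hm, hka, ?_, ?_, hr0, ?_, ?_, by linarith, hC1, ?_, by linarith,
    ?_, ?_, ?_⟩
  · refine hk.trans ?_
    have h0 : 0 ≤ Real.log m := hlog2.le.trans hlogm
    gcongr
    linarith
  · calc ∑ j, |a j| ≤ 2 / Real.log 2 * Real.log 2 := by rwa [div_mul_cancel₀ _ hlog2.ne']
      _ ≤ K * Real.log m := by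
        gcongr
        linarith
  · rwa [one_mul]
  · refine hrT.trans ?_
    gcongr
    linarith
  · calc _ = ‖(C.successOp h - evolution (hamiltonian h) t) -
          (multiproduct h k a (t / r) ^ r - evolution (hamiltonian h) t)‖ := by
          rw [sub_sub_sub_cancel_right]
      _ ≤ ε / 4 + ε / 4 := (norm_sub_le _ _).trans (add_le_add hAW hXW)
      _ ≤ ε := by linarith
  · intro ψ hψ
    obtain ⟨h1, h2, h3⟩ := normalized_output_bounds (by linarith) hAW hψ
      (by rw [norm_evolution_apply (isSelfAdjoint_hamiltonian hh), hψ])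
    refine ⟨h1, le_trans ?_ h2, h3.trans (by linarith)⟩
    have : 1 * ε ≤ K * ε := by
      gcongr
      linarith
    linarith
  · have h1 : (C.queryCount : ℝ) ≤ r * (3 * ∑ j, (k j : ℝ)) := by exact_mod_cast hC3
    calc (C.queryCount : ℝ) ≤ r * (3 * ∑ j, (k j : ℝ)) := h1
      _ ≤ ρ * T * (3 * (K₁ * ((K₂ * L) ^ 2 / Real.log 2))) := by
        gcongr
        exact hk.trans (by gcongr)
      _ = Kq * (T * L ^ 2) := by rw [hKq]; ring
      _ ≤ K * (T * L ^ 2) := by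
        gcongr
        linarith
  · have h1 : (C.gateCount : ℝ) ≤ r * (6 * M + 10) := by exact_mod_cast hC2
    calc (C.gateCount : ℝ) ≤ r * (6 * M + 10) := h1
      _ ≤ ρ * T * ((6 * K₁ + 10) * (K₂ * L / Real.log 2)) := by
        gcongr
        calc 6 * (M : ℝ) + 10 ≤ 6 * (K₁ * m) + 10 * m := by linarith
          _ = (6 * K₁ + 10) * m := by ring
          _ ≤ _ := by gcongr
      _ = Kg * (T * L) := by rw [hKg]; ring
      _ ≤ K * (T * L) := by
        gcongr
        linarith
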